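/- **Theorem (nonlinear Granger–Johansen representation theorem).** *Setting.* Let $p\ge 0$, $k\ge 1$, $0\le r\le p$. Consider the nonlinear VAR($k$) in $\mathbb R^p$ $$f_0(z_t)=c+\sum_{i=1}^k f_i(z_{t-i})+u_t ,\qquad(1)$$ with $c\in\mathbb R^p$ and $f_i:\mathbb R^p\to\mathbb R^p$, $0\le i\le k$. Put $$\pi(z)=-f_0(z)+\sum_{i=1}^k f_i(z),\qquad g_j(z)=-\sum_{i=j+1}^k f_i(z),\qquad \mathbf g=(g_1,\dots,g_{k-1}).$$ Let $D$ be the $p(k-1)\times p(k-1)$ block matrix with $-I_p$ on the diagonal, $I_p$ on the first block superdiagonal and $0$ elsewhere, and let $E$ be the $p(k-1)\times p$ matrix whose first $p\times p$ block is $I_p$ and whose other blocks are $0$ (both are empty if $k=1$). For $\alpha\in\mathbb R^{p\times r}$ set $$\boldsymbol\alpha=\begin{bmatrix}\alpha&E'\\0&I_{p(k-1)}\end{bmatrix},\qquad \mathbf D_0=\begin{bmatrix}0_{r\times p}&0\\0&D\end{bmatrix}.$$ Matrix norms are those induced by the Euclidean norm. For a bounded set $\mathcal A$ of square matrices, $$\rho_{\mathrm{JSR}}(\mathcal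 A)=\limsup_{t\to\infty}\ \sup_{B\in\mathcal A^t}\rho(B)^{1/t},$$ where $\mathcal A^t$ is the set of $t$-fold products of elements of $\mathcal A$ and $\rho(B)$ is the spectral radius. *Class $\mathcal M_r(\alpha,\bar b,\bar\rho)$.* Let $\alpha\in\mathbb R^{p\times r}$ have rank $r$, $\bar b\in\mathbb R$ and $\bar\rho\in[0,1)$. Assume that the model (1) belongs to this class, with witnesses $\mu$, $\theta$, $\mathcal B$: 1. $f_0$ is a homeomorphism of $\mathbb R^p$; 2. $\mu\in\mathbb R^r$ and $\theta:\mathbb R^p\to\mathbb R^r$ satisfy $c=\alpha\mu$ and $\pi(z)=\alpha\theta(z)$ for all $z\in\mathbb R^p$; 3. $\mathcal B\subset\mathbb R^{pk\times[p(k-1)+r]}$ is closed, $\|\boldsymbol\beta\|\le\bar b$ for all $\boldsymbol\beta\in\mathcal B$, $\rho_{\mathrm{JSR}}(\{I+\boldsymbol\beta'\boldsymbol\alpha:\boldsymbol\beta\in\mathcal B\})\le\bar\rho$, and, with $\boldsymbol\theta=(\theta,\mathbf g)$, for all $\mathbf z=(z,\zeta)$ and $\mathbf z^*=(z^*,\zeta^*)$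 in $\mathbb R^p\times\mathbb R^{p(k-1)}$ there is $\boldsymbol\beta\in\mathcal B$ with $$[\boldsymbol\theta(f_0^{-1}(z))+\mathbf D_0\mathbf z]-[\boldsymbol\theta(f_0^{-1}(z^*))+\mathbf D_0\mathbf z^*]=\boldsymbol\beta'(\mathbf z-\mathbf z^*).$$ Let $\alpha_\perp$ be any $p\times(p-r)$ matrix of rank $p-r$ with $\alpha_\perp'\alpha=0$. Let $(z_t)_{t\in\mathbb Z}$ and $(u_t)_{t\in\mathbb Z}$ be sequences in $\mathbb R^p$ that satisfy (1) for all $t\ge1$ (the initial values $z_0,\dots,z_{-k+1}$ are arbitrary). Put $\boldsymbol\zeta_t=(\zeta_{1,t},\dots,\zeta_{k-1,t})$ with $\zeta_{j,t}=\sum_{i=j}^{k-1}g_i(z_{t-i+j})$, $\mathbf z_t=(z_t,\boldsymbol\zeta_{t-1})$, $\boldsymbol\mu=(\mu,0)$, $\mathbf u_t=(u_t,0)$, $\Delta\boldsymbol\zeta_t=\boldsymbol\zeta_t-\boldsymbol\zeta_{t-1}$, and $$\boldsymbol\xi_t=\boldsymbol\mu+\boldsymbol\theta(z_t)+\mathbf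 D_0\mathbf z_t .$$ Define also $$\chi(z)=\begin{bmatrix}\psi(z)\\\theta(z)\end{bmatrix},\qquad \psi(z)=\alpha_\perp'\Big[f_0(z)-\sum_{i=1}^{k-1}g_i(z)\Big],\qquad \bar h(\vec z_0)=f_0(z_0)-\sum_{i=1}^{k-1}g_i(z_{-i}),$$ $$S_\chi'=\begin{bmatrix}-\alpha_\perp'&0\\0&I_r\end{bmatrix}\begin{bmatrix}0_{p\times r}&I_p&\cdots&I_p\\I_r&0_{r\times p}&\cdots&0_{r\times p}\end{bmatrix}.$$ *Conclusion.* The map $\chi:\mathbb R^p\to\mathbb R^p$ is a homeomorphism, and for every $t\ge0$ $$z_t=\chi^{-1}\left(\begin{bmatrix}\alpha_\perp'\bar h(\vec z_0)+\alpha_\perp'\sum_{s=1}^t u_s\\-\mu\end{bmatrix}+S_\chi'\boldsymbol\xi_t\right),\qquad \boldsymbol\xi_t=\begin{bmatrix}\mu+\theta(z_t)\\\Delta\boldsymbol\zeta_t\end{bmatrix}.$$ Moreover there are $\boldsymbol\beta_t\in\mathcal B$, $t\ge1$, such that for all $t\ge1$ $$\boldsymbol\xi_t=(I_{p(k-1)+r}+\boldsymbol\beta_t'\boldsymbol\alpha)\,\boldsymbol\xi_{t-1}+\boldsymbol\beta_t'\mathbf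 u_t ,$$ and this time-varying VAR is exponentially stable: the set of loadings $\{\boldsymbol\beta':\boldsymbol\beta\in\mathcal B\}$ is bounded, and there are $C<\infty$ and $\varrho\in[0,1)$ such that $\|A_1A_2\cdots A_n\|\le C\varrho^n$ for all $n\ge0$ and all $A_1,\dots,A_n\in\{I+\boldsymbol\beta'\boldsymbol\alpha:\boldsymbol\beta\in\mathcal B\}$. -/

import Mathlib

open Matrix
open scoped Matrix.Norms.L2Operator

/-- Column vectors of length `n`, i.e. the space `ℝⁿ`. -/
abbrev Vec (n : ℕ) : Type := Fin n → ℝ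

/-- Index type of the `p(k-1)` coordinates of `(ζ_1, …, ζ_{k-1})`, each `ζ_j` being in `ℝᵖ`;
the pair `(j, a)` (with `j` counted from `0`) is coordinate `a` of the block `ζ_{j+1}`. -/
abbrev LagIdx (p k : ℕ) : Type := Fin (k - 1) × Fin p

/-- Index type of the `kp` coordinates of `𝐳 = (z, ζ)`. -/
abbrev StateIdx (p k : ℕ) : Type := Fin p ⊕ LagIdx p k

/-- Index type of the `r + p(k-1)` coordinates of `𝛏 = (ξ, Δζ)`. -/
abbrev DevIdx (p k r : ℕ) : Type := Fin r ⊕ LagIdx p k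

/-- The parameters of the nonlinear VAR(`k`)
`f_0(z_t) = c + ∑_{i=1}^k f_i(z_{t-i}) + u_t` in `ℝᵖ` (only `f 0, …, f k` are ever used). -/
structure NonlinVAR (p k : ℕ) where
  c : Vec p
  f : ℕ → Vec p → Vec p

noncomputable section

namespace NonlinVAR

variable {p k : ℕ} (V : NonlinVAR p k)

/-- `z` satisfies the model equation with shocks `u` for all `t ≥ 1`, from arbitrary
initial values `z_0, …, z_{-k+1}`. -/
def Follows (z u : ℤ → Vec p) : Prop :=
  ∀ t : ℤ, 1 ≤ t → V.f 0 (z t) = V.c + ∑ i ∈ Finset.Icc 1 k, V.f i (z (t - (i : ℤ))) + u t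

/-- `g_j(z) = -∑_{i=j+1}^k f_i(z)`. -/
def g (j : ℕ) (x : Vec p) : Vec p := -∑ i ∈ Finset.Icc (j + 1) k, V.f i x

/-- `π(z) = -f_0(z) + ∑_{i=1}^k f_i(z)`. -/
def piMap (x : Vec p) : Vec p := -V.f 0 x + ∑ i ∈ Finset.Icc 1 k, V.f i x

/-- The stacked vector `(g_1(z), …, g_{k-1}(z))`. -/
def gStack (x : Vec p) : LagIdx p k → ℝ := fun ja => V.g (ja.1 + 1) x ja.2

/-- The stacked vector `(ζ_{1,t}, …, ζ_{k-1,t})`, `ζ_{j,t} = ∑_{i=j}^{k-1} g_i(z_{t-i+j})`. -/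
def zeta (z : ℤ → Vec p) (t : ℤ) : LagIdx p k → ℝ := fun ja =>
  ∑ i ∈ Finset.Icc ((ja.1 : ℕ) + 1) (k - 1),
    V.g i (z (t - (i : ℤ) + (((ja.1 : ℕ) + 1 : ℕ) : ℤ))) ja.2

/-- `𝐳_t = (z_t, ζ_{t-1})`. -/
def state (z : ℤ → Vec p) (t : ℤ) : StateIdx p k → ℝ := Sum.elim (z t) (V.zeta z (t - 1))

/-- `𝛉(z) = (θ(z), g_1(z), …, g_{k-1}(z))`. -/
def thetaStack {r : ℕ} (θ : Vec p → Vec r) (x : Vec p) : DevIdx p k r → ℝ :=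
  Sum.elim (θ x) (V.gStack x)

/-- `ψ(z) = α_⊥ᵀ [f_0(z) - ∑_{i=1}^{k-1} g_i(z)]`. -/
def psi {q : ℕ} (αperp : Matrix (Fin p) (Fin q) ℝ) (x : Vec p) : Vec q :=
  αperpᵀ *ᵥ (V.f 0 x - ∑ i ∈ Finset.Icc 1 (k - 1), V.g i x)

/-- `h̄(z_s, …, z_{s-k+1}) = f_0(z_s) - ∑_{i=1}^{k-1} g_i(z_{s-i})`. -/
def hbar (z : ℤ → Vec p) (s : ℤ) : Vec p :=
  V.f 0 (z s) - ∑ i ∈ Finset.Icc 1 (k - 1), V.g i (z (s - (i : ℤ)))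

end NonlinVAR

/-- The block matrix `D` of size `p(k-1)`: `-I_p` on the diagonal, `I_p` on the first block
superdiagonal, `0` elsewhere. -/
def matD (p k : ℕ) : Matrix (LagIdx p k) (LagIdx p k) ℝ :=
  Matrix.of fun ja lb =>
    if ja.2 = lb.2 then
      (if lb.1 = ja.1 then -1 else if (lb.1 : ℕ) = (ja.1 : ℕ) + 1 then 1 else 0)
    else 0

/-- `𝐃_0 = [0, 0; 0, D]`. -/
def matD0 (p k r : ℕ) : Matrix (DevIdx p k r) (StateIdx p k) ℝ :=
  Matrix.fromBlocks 0 0 0 (matD p k)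

/-- `E = [I_p; 0; …; 0]`, of size `p(k-1) × p` (an empty matrix if `k = 1`). -/
def matE (p k : ℕ) : Matrix (LagIdx p k) (Fin p) ℝ :=
  Matrix.of fun ja b => if (ja.1 : ℕ) = 0 ∧ ja.2 = b then 1 else 0

/-- `𝛂 = [α, Eᵀ; 0, I]`. -/
def alphaStack {p r : ℕ} (k : ℕ) (α : Matrix (Fin p) (Fin r) ℝ) :
    Matrix (StateIdx p k) (DevIdx p k r) ℝ :=
  Matrix.fromBlocks α (matE p k)ᵀ 0 1

/-- `𝐮_t = (u_t, 0)`. -/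
def shockStack {p : ℕ} (k : ℕ) (u : Vec p) : StateIdx p k → ℝ := Sum.elim u 0

/-- The identification of coordinates behind `ℝ^{p-r} × ℝʳ = ℝᵖ`. -/
def splitIdx {p r : ℕ} (hr : r ≤ p) : Fin (p - r) ⊕ Fin r ≃ Fin p :=
  finSumFinEquiv.trans (finCongr (Nat.sub_add_cancel hr))

/-- The column vector `[x; y]` in `ℝᵖ`, for `x ∈ ℝ^{p-r}` and `y ∈ ℝʳ`. -/
def stack {p r : ℕ} (hr : r ≤ p) (x : Vec (p - r)) (y : Vec r) : Vec p :=
  fun i => Sum.elim x y ((splitIdx hr).symm i)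

/-- `χ(z) = [ψ(z); θ(z)]`. -/
def NonlinVAR.chi {p k r : ℕ} (V : NonlinVAR p k) (hr : r ≤ p)
    (αperp : Matrix (Fin p) (Fin (p - r)) ℝ) (θ : Vec p → Vec r) (x : Vec p) : Vec p :=
  stack hr (V.psi αperp x) (θ x)

/-- `𝛏_t = 𝛍 + 𝛉(z_t) + 𝐃_0 𝐳_t`, where `𝛍 = (μ, 0)`. -/
def NonlinVAR.xi {p k r : ℕ} (V : NonlinVAR p k) (μ : Vec r) (θ : Vec p → Vec r)
    (z : ℤ → Vec p) (t : ℤ) : DevIdx p k r → ℝ :=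
  Sum.elim μ 0 + V.thetaStack θ (z t) + matD0 p k r *ᵥ V.state z t

/-- The `p × [r + p(k-1)]` matrix
`S_χᵀ = [-α_⊥ᵀ, 0; 0, I_r] [0, I_p, …, I_p; I_r, 0, …, 0]`. -/
def matS {p r : ℕ} (k : ℕ) (hr : r ≤ p) (αperp : Matrix (Fin p) (Fin (p - r)) ℝ) :
    Matrix (Fin p) (DevIdx p k r) ℝ :=
  ((Matrix.fromBlocks (-αperpᵀ) 0 0 1 :
        Matrix (Fin (p - r) ⊕ Fin r) (Fin p ⊕ Fin r) ℝ) *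
      (Matrix.fromBlocks 0 (Matrix.of fun a lb => if a = lb.2 then 1 else 0) 1 0 :
        Matrix (Fin p ⊕ Fin r) (DevIdx p k r) ℝ)).submatrix (splitIdx hr).symm id

open scoped Pointwise in
/-- `limsup_{t → ∞} sup_{B ∈ 𝒜ᵗ} ρ(B)^{1/t}`, where `𝒜ᵗ` is the set of `t`-fold products of
elements of `𝒜` and `ρ(B)` is the largest modulus of a complex eigenvalue of `B`. -/
def jointSpectralRadius {ι : Type*} [Fintype ι] [DecidableEq ι] (𝒜 : Set (Matrix ι ι ℝ)) :
    ENNReal :=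
  Filter.limsup
    (fun t : ℕ => ⨆ B ∈ 𝒜 ^ t,
      spectralRadius ℂ (B.map (algebraMap ℝ ℂ)) ^ ((t : ℝ)⁻¹))
    Filter.atTop

/-- The set of matrices `I + 𝛃ᵀ𝛂`, `𝛃 ∈ ℬ`. -/
def transitionSet {p r : ℕ} (k : ℕ) (α : Matrix (Fin p) (Fin r) ℝ)
    (ℬ : Set (Matrix (StateIdx p k) (DevIdx p k r) ℝ)) :
    Set (Matrix (DevIdx p k r) (DevIdx p k r) ℝ) :=
  {A | ∃ β ∈ ℬ, A = 1 + βᵀ * alphaStack k α}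

/-- The model belongs to the class `ℳ_r(α, b, ρ)`, with `μ`, `θ` and `ℬ` as witnesses.
`‖β‖` is the matrix norm induced by the Euclidean norm. -/
structure NonlinVAR.MemClass {p k r : ℕ} (V : NonlinVAR p k) (α : Matrix (Fin p) (Fin r) ℝ)
    (b ρ : ℝ) (μ : Vec r) (θ : Vec p → Vec r)
    (ℬ : Set (Matrix (StateIdx p k) (DevIdx p k r) ℝ)) : Prop where
  rank_eq : α.rank = r
  rho_nonneg : 0 ≤ ρ
  rho_lt_one : ρ < 1
  homeo : IsHomeomorph (V.f 0)
  c_eq : V.c = α *ᵥ μ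
  pi_eq : ∀ x : Vec p, V.piMap x = α *ᵥ θ x
  closed : IsClosed ℬ
  bound : ∀ β ∈ ℬ, ‖β‖ ≤ b
  gradient : ∀ (x x' : Vec p) (ζ ζ' : LagIdx p k → ℝ), ∃ β ∈ ℬ,
    (V.thetaStack θ ((homeo.homeomorph (V.f 0)).symm x) + matD0 p k r *ᵥ Sum.elim x ζ)
      - (V.thetaStack θ ((homeo.homeomorph (V.f 0)).symm x') + matD0 p k r *ᵥ Sum.elim x' ζ')
      = βᵀ *ᵥ (Sum.elim x ζ - Sum.elim x' ζ')
  jsr_le : jointSpectralRadius (transitionSet k α ℬ) ≤ ENNReal.ofReal ρ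

/-- The sequence `w` follows, for `t ≥ 1`, the time-varying VAR
`w_t = c_t + A_t w_{t-1} + B_t v_t` with `A_t ∈ 𝒜`, `B_t ∈ ℬ`, `c_t ∈ 𝒞`, and is exponentially
stable: `ℬ` and `𝒞` are bounded and, for some `C` and `ρ < 1`, every product of `n` matrices
from `𝒜` has norm at most `C ρⁿ`. This covers the products `A_t ⋯ A_1` and `A_1 ⋯ A_t`,
and also those that start at a later date. -/
def ExpStableVAR {ι κ : Type*} [Fintype ι] [DecidableEq ι] [Fintype κ] [DecidableEq κ]
    (𝒜 : Set (Matrix ι ι ℝ)) (ℬ : Set (Matrix ι κ ℝ)) (𝒞 : Set (ι → ℝ))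
    (c : ℤ → ι → ℝ) (A : ℤ → Matrix ι ι ℝ) (B : ℤ → Matrix ι κ ℝ)
    (v : ℤ → κ → ℝ) (w : ℤ → ι → ℝ) : Prop :=
  (∀ t : ℤ, 1 ≤ t → A t ∈ 𝒜 ∧ B t ∈ ℬ ∧ c t ∈ 𝒞 ∧
      w t = c t + A t *ᵥ w (t - 1) + B t *ᵥ v t) ∧
    Bornology.IsBounded ℬ ∧ Bornology.IsBounded 𝒞 ∧
    ∃ C ρ : ℝ, 0 ≤ ρ ∧ ρ < 1 ∧
      ∀ l : List (Matrix ι ι ℝ), (∀ M ∈ l, M ∈ 𝒜) → ‖l.prod‖ ≤ C * ρ ^ l.length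

end

/-! Two facts carry the theorem. The first is the Berger–Wang inequality
(`exists_norm_prod_le_of_jointSpectralRadius_lt_one`): a joint spectral radius below one makes the
norms of long products of matrices `1 + βᵀ𝛂` decay exponentially. Spectral radii bound traces, so
the traces of long products decay. In the algebra generated by the matrices, the radical of the
trace form is a nil ideal, hence nilpotent. A long product has small trace against every product of
generators, hence lies close to this ideal, and a product of many elements close to a nilpotent
ideal is small.

The second is a global inversion (`exists_continuous_inverse_of_gradient_restriction`). Let `G(x, ζ)
= 𝛉(f_0⁻¹ x) + 𝐃_0 (x, ζ)` and `P = α_⊥ᵀ [I, -Eᵀ]`, whose kernel is the range of `𝛂`. On a fibre `P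
s = q` the map `w ↦ w + G(R q + 𝛂 w) - m` has increments `(1 + βᵀ𝛂)(w - w')`, so by the decay an
iterate of it is a contraction. Hence `s ↦ (P s, G s)` is a bijection with Lipschitz inverse, and
`χ` is its restriction to the states at which `Δζ` vanishes.

The dynamics come from summation by parts: `h̄` has increments `α(μ + θ(z_{t-1})) + u_t`, from which
`α_⊥ᵀ` removes the first term, and `(f_0(z_t), ζ_{t-1})` has increments `𝛂 𝛏_{t-1} + 𝐮_t`, to which
the gradient condition applies. -/

/-! ### Nilpotency: traces and nil ideals. -/

/-- A square matrix over a field of characteristic zero all of whose positive powers have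
trace zero is nilpotent. -/
theorem Matrix.isNilpotent_of_forall_trace_pow_eq_zero {ι K : Type*} [Fintype ι] [DecidableEq ι]
    [Field K] [CharZero K] (x : Matrix ι ι K) (h : ∀ n : ℕ, (x ^ (n + 1)).trace = 0) :
    IsNilpotent x := by
  have hint : IsIntegral K x := Matrix.isIntegral x
  obtain ⟨s, hs, hdvd⟩ := Polynomial.exists_eq_pow_rootMultiplicity_mul_and_not_dvd
    (minpoly K x) (minpoly.ne_zero hint) 0
  rw [map_zero, sub_zero] at hs hdvd
  set a := Polynomial.rootMultiplicity 0 (minpoly K x)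
  -- The exponent `a + 1` instead of `a` removes the constant term of the idempotent `e` below even
  -- if `a = 0`, so that the trace hypothesis applies to it.
  have hcop : IsCoprime ((Polynomial.X : Polynomial K) ^ (a + 1)) s :=
    IsCoprime.pow_left ((Polynomial.irreducible_X.coprime_iff_not_dvd).2 hdvd)
  obtain ⟨v, w, hvw⟩ := hcop
  have hzero : x ^ a * Polynomial.aeval x s = 0 := by
    have := minpoly.aeval K x
    rw [hs] at this
    simpa using this
  have hone : Polynomial.aeval x v * x ^ (a + 1) + Polynomial.aeval x w * Polynomial.aeval x s
      = 1 := by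
    have := congrArg (Polynomial.aeval x) hvw
    simpa using this
  have hcomm (q₁ q₂ : Polynomial K) : Polynomial.aeval x q₁ * Polynomial.aeval x q₂
      = Polynomial.aeval x q₂ * Polynomial.aeval x q₁ := by
    rw [← map_mul, mul_comm, map_mul]
  have hcs : x ^ (a + 1) * (Polynomial.aeval x w * Polynomial.aeval x s) = 0 := by
    rw [hcomm w s, pow_succ', mul_assoc, ← mul_assoc (x ^ a), hzero, zero_mul, mul_zero]
  -- `e` is the Fitting projection onto the part where `x` is invertible. In characteristic zero an
  -- idempotent of trace zero vanishes.
  set e := Polynomial.aeval x v * x ^ (a + 1) with he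
  have hidem : IsIdempotentElem e := by
    have : e * (Polynomial.aeval x w * Polynomial.aeval x s) = 0 := by
      rw [he, mul_assoc, hcs, mul_zero]
    have h2 : e * (e + Polynomial.aeval x w * Polynomial.aeval x s) = e := by
      rw [hone, mul_one]
    rw [mul_add, this, add_zero] at h2
    exact h2
  have htr (q : Polynomial K) : (Polynomial.aeval x q * x ^ (a + 1)).trace = 0 := by
    rw [Polynomial.aeval_eq_sum_range, Finset.sum_mul, Matrix.trace_sum]
    refine Finset.sum_eq_zero fun i _ => ?_
    rw [smul_mul_assoc, ← pow_add, Matrix.trace_smul, ← add_assoc, h, smul_zero]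
  have he0 : e = 0 := by
    have hid : IsIdempotentElem (Matrix.toLin' e) := by
      rw [IsIdempotentElem, Module.End.mul_eq_comp, ← Matrix.toLin'_mul, hidem.eq]
    have := LinearMap.IsIdempotentElem.eq_zero_of_trace_eq_zero hid
      (by rw [Matrix.trace_toLin'_eq]; exact htr v)
    simpa using this
  refine ⟨a, ?_⟩
  have hx : x ^ a * (e + Polynomial.aeval x w * Polynomial.aeval x s) = x ^ a := by
    rw [hone, mul_one]
  rw [he0, zero_add, hcomm w s, ← mul_assoc, hzero, zero_mul] at hx
  exact hx.symm

/-- In an Artinian ring, a left ideal consisting of nilpotent elements is nilpotent. -/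
theorem Ideal.exists_pow_eq_bot_of_forall_isNilpotent {R : Type*} [Ring R] [IsArtinianRing R]
    (J : Ideal R) (hJ : ∀ x ∈ J, IsNilpotent x) : ∃ n : ℕ, J ^ n = ⊥ := by
  obtain ⟨n, hn⟩ := IsSemiprimaryRing.isNilpotent (R := R)
  refine ⟨n, ?_⟩
  -- Since `y * x` is nilpotent, `y * x + 1` is a unit, so `J` lies in the Jacobson radical, which
  -- is nilpotent in an Artinian ring.
  have hle : J ≤ Ring.jacobson R := by
    intro x hx
    rw [← Ideal.jacobson_bot, Ideal.mem_jacobson_iff]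
    intro y
    obtain ⟨w, hw⟩ := (hJ (y * x) (J.mul_mem_left y hx)).isUnit_add_one
    refine ⟨((w⁻¹ : Rˣ) : R), ?_⟩
    have : ((w⁻¹ : Rˣ) : R) * (y * x + 1) = 1 := by rw [← hw, Units.inv_mul]
    rw [mul_assoc, ← mul_add_one, this, sub_self]
    exact Submodule.zero_mem _
  exact le_bot_iff.1 ((Ideal.pow_right_mono hle n).trans hn.le)

/-- On a finite-dimensional space, a vector on which all functionals of a family are small is close
to their common kernel. -/
theorem exists_forall_exists_norm_sub_le_of_functionals {W : Type*} [NormedAddCommGroup W]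
    [NormedSpace ℝ W] [FiniteDimensional ℝ W] (S : Set (Module.Dual ℝ W)) :
    ∃ C : ℝ, 0 ≤ C ∧ ∀ (x : W) (ε : ℝ), 0 ≤ ε → (∀ ℓ ∈ S, |ℓ x| ≤ ε) →
      ∃ y : W, (∀ ℓ ∈ S, ℓ y = 0) ∧ ‖x - y‖ ≤ C * ε := by
  -- Finitely many functionals from `S` span all of them. Subtracting a linear preimage of their
  -- values on `x` lands in the common kernel, at a cost linear in these values.
  obtain ⟨b, hbS, hspan, hlin⟩ := exists_linearIndependent ℝ S
  have : Finite b := hlin.finite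
  have : Fintype b := Fintype.ofFinite b
  let T : W →ₗ[ℝ] (b → ℝ) := LinearMap.pi fun ℓ => (ℓ : Module.Dual ℝ W)
  obtain ⟨g, hg⟩ := T.rangeRestrict.exists_rightInverse_of_surjective T.range_rangeRestrict
  obtain ⟨G, hG⟩ := g.exists_extend
  refine ⟨‖LinearMap.toContinuousLinearMap G‖, norm_nonneg _, fun x ε hε hx => ?_⟩
  refine ⟨x - G (T x), ?_, ?_⟩
  · have hT : T (x - G (T x)) = 0 := by
      have h1 : G (T x) = g (T.rangeRestrict x) := by rw [← hG]; rfl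
      have h2 := LinearMap.congr_fun hg (T.rangeRestrict x)
      have h3 : T (g (T.rangeRestrict x)) = T x := congrArg Subtype.val h2
      rw [map_sub, h1, h3, sub_self]
    have hle : Submodule.span ℝ b ≤ LinearMap.ker (Module.Dual.eval ℝ W (x - G (T x))) := by
      rw [Submodule.span_le]
      intro ℓ hℓ
      exact congrFun hT ⟨ℓ, hℓ⟩
    intro ℓ hℓ
    exact hle (hspan ▸ Submodule.subset_span hℓ)
  · rw [sub_sub_cancel]
    refine (ContinuousLinearMap.le_opNorm (LinearMap.toContinuousLinearMap G) (T x)).trans ?_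
    refine mul_le_mul_of_nonneg_left ?_ (norm_nonneg _)
    exact (pi_norm_le_iff_of_nonneg hε).2 fun ℓ => hx ℓ (hbS ℓ.2)

/-! ### Products near a nilpotent ideal. -/

/-- Products of elements that are close to a nilpotent two-sided ideal, graded by the powers of
that ideal. -/
theorem Ideal.exists_graded_decomposition_prod {R : Type*} [NormedRing R] (J : Ideal R)
    [J.IsTwoSided] {d : ℕ} (hJ : J ^ (d + 1) = ⊥) {ε M δ : ℝ} (hε : 0 ≤ ε) (hM : 0 ≤ M)
    (hδ : 0 ≤ δ) (l : List R) (hl : ∀ b ∈ l, ∃ j ∈ J, ‖b - j‖ ≤ ε ∧ ‖j‖ ≤ M) :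
    ∃ f : ℕ → R, (∀ i, f i ∈ J ^ i) ∧ l.prod = ∑ i ∈ Finset.range (d + 1), f i ∧
      ∑ i ∈ Finset.range (d + 1), δ ^ i * ‖f i‖ ≤ (ε + δ * M) ^ l.length * ‖(1 : R)‖ := by
  have hJ0 (x : R) : x ∈ J ^ 0 := by
    rw [Submodule.pow_zero, Ideal.one_eq_top]
    exact Submodule.mem_top
  induction l with
  | nil =>
    refine ⟨fun i => if i = 0 then 1 else 0, fun i => ?_, ?_, ?_⟩
    · by_cases hi : i = 0
      · subst hi
        exact hJ0 _
      · simp [hi]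
    · simp
    · rw [Finset.sum_range_succ']
      simp
  | cons b l ih =>
    obtain ⟨f, hf, hprod, hsum⟩ := ih fun x hx => hl x (List.mem_cons_of_mem b hx)
    obtain ⟨j, hj, hbj, hjM⟩ := hl b List.mem_cons_self
    have hjf (i : ℕ) : j * f i ∈ J ^ (i + 1) := by
      rw [Ideal.IsTwoSided.pow_succ]
      exact Ideal.mul_mem_mul hj (hf i)
    obtain ⟨g, hg0, hg⟩ : ∃ g : ℕ → R, g 0 = 0 ∧ ∀ i, g (i + 1) = j * f i :=
      ⟨fun i => Nat.casesOn i 0 fun i => j * f i, rfl, fun _ => rfl⟩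
    -- Split `b = (b - j) + j`: the first summand keeps the degree and costs `ε`, the second raises
    -- it by one and costs `δ * M` in the weighted sum. Degree `d + 1` vanishes.
    refine ⟨fun i => (b - j) * f i + g i, ?_, ?_, ?_⟩
    · rintro (_ | i)
      · exact hJ0 _
      · simp only [hg]
        exact Ideal.add_mem _ (Ideal.mul_mem_left _ _ (hf _)) (hjf i)
    · have hlast : j * f d = 0 := by simpa [hJ] using hjf d
      rw [List.prod_cons, hprod, Finset.sum_add_distrib, ← Finset.mul_sum]
      rw [Finset.sum_range_succ' g d, hg0, add_zero]
      simp only [hg]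
      rw [← Finset.mul_sum, sub_mul,
        Finset.sum_range_succ, mul_add j, hlast, add_zero, sub_add_cancel]
    · have hpos : 0 ≤ ε + δ * M := add_nonneg hε (mul_nonneg hδ hM)
      have key : ∑ i ∈ Finset.range (d + 1),
          δ ^ i * ‖(b - j) * f i + g i‖
          ≤ (ε + δ * M) * ∑ i ∈ Finset.range (d + 1), δ ^ i * ‖f i‖ := by
        calc _ ≤ ∑ i ∈ Finset.range (d + 1), (ε * (δ ^ i * ‖f i‖)
                + δ ^ i * ‖g i‖) := by
              refine Finset.sum_le_sum fun i _ => ?_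
              have h1 : ‖(b - j) * f i‖ ≤ ε * ‖f i‖ :=
                (norm_mul_le _ _).trans (mul_le_mul_of_nonneg_right hbj (norm_nonneg _))
              have h2 := (norm_add_le ((b - j) * f i) (g i)).trans
                (add_le_add_left h1 _)
              have h3 := mul_le_mul_of_nonneg_left h2 (pow_nonneg hδ i)
              refine h3.trans (le_of_eq (by ring))
          _ = ε * ∑ i ∈ Finset.range (d + 1), δ ^ i * ‖f i‖
                + ∑ i ∈ Finset.range d, δ ^ (i + 1) * ‖j * f i‖ := by
              rw [Finset.sum_add_distrib, ← Finset.mul_sum,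
                Finset.sum_range_succ' (fun i => δ ^ i * ‖g i‖) d]
              simp only [hg, hg0, norm_zero, mul_zero, add_zero]
          _ ≤ ε * ∑ i ∈ Finset.range (d + 1), δ ^ i * ‖f i‖
                + δ * M * ∑ i ∈ Finset.range (d + 1), δ ^ i * ‖f i‖ := by
              refine add_le_add_right ?_ _
              rw [Finset.mul_sum]
              refine (Finset.sum_le_sum fun i _ => ?_).trans
                (Finset.sum_le_sum_of_subset_of_nonneg
                  (Finset.range_subset_range.2 d.le_succ) fun i _ _ => by positivity)
              have h1 : ‖j * f i‖ ≤ M * ‖f i‖ :=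
                (norm_mul_le _ _).trans (mul_le_mul_of_nonneg_right hjM (norm_nonneg _))
              have h3 := mul_le_mul_of_nonneg_left h1 (pow_nonneg hδ (i + 1))
              refine h3.trans (le_of_eq (by ring))
          _ = _ := by ring
      refine key.trans ((mul_le_mul_of_nonneg_left hsum hpos).trans (le_of_eq ?_))
      rw [List.length_cons]
      ring

/-- Long products of elements that are close to a nilpotent two-sided ideal are small. -/
theorem Ideal.exists_norm_prod_le_half {R : Type*} [NormedRing R] (J : Ideal R) [J.IsTwoSided]
    {n : ℕ} (hJ : J ^ n = ⊥) {M : ℝ} (hM : 0 ≤ M) :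
    ∃ m : ℕ, 1 ≤ m ∧ ∀ l : List R, l.length = m →
      (∀ b ∈ l, ∃ j ∈ J, ‖b - j‖ ≤ 1 / 4 ∧ ‖j‖ ≤ M) → ‖l.prod‖ ≤ 1 / 2 := by
  have hJ' : J ^ (n + 1) = ⊥ := le_bot_iff.1 ((Ideal.pow_le_pow_right n.le_succ).trans hJ.le)
  -- This weight makes each factor cost at most `1/4 + δ * M ≤ 1/2`. Undoing the weights costs only
  -- the fixed factor `δ⁻ⁿ`, which a large `m` absorbs.
  set δ : ℝ := 1 / (4 * (M + 1)) with hδdef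
  have hδ : 0 < δ := by positivity
  have hδ1 : δ ≤ 1 := by
    rw [hδdef, div_le_one (by positivity)]
    linarith
  have hδM : 1 / 4 + δ * M ≤ 1 / 2 := by
    have : δ * (4 * (M + 1)) = 1 := by rw [hδdef]; field_simp
    nlinarith
  have htend : Filter.Tendsto (fun m : ℕ => (1 / 2 : ℝ) ^ m * ‖(1 : R)‖) Filter.atTop (nhds 0) := by
    simpa using (tendsto_pow_atTop_nhds_zero_of_lt_one (by norm_num : (0 : ℝ) ≤ 1 / 2)
      (by norm_num)).mul_const ‖(1 : R)‖
  obtain ⟨m, hm1, hm⟩ := ((Filter.eventually_ge_atTop 1).and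
    (htend.eventually_le_const (show (0 : ℝ) < δ ^ n * (1 / 2) by positivity))).exists
  refine ⟨m, hm1, fun l hlen hl => ?_⟩
  obtain ⟨f, -, hprod, hsum⟩ :=
    J.exists_graded_decomposition_prod hJ' (by norm_num) hM hδ.le l hl
  have h1 : δ ^ n * ‖l.prod‖ ≤ ∑ i ∈ Finset.range (n + 1), δ ^ i * ‖f i‖ := by
    rw [hprod]
    refine (mul_le_mul_of_nonneg_left (norm_sum_le _ _) (by positivity)).trans ?_
    rw [Finset.mul_sum]
    refine Finset.sum_le_sum fun i hi => mul_le_mul_of_nonneg_right ?_ (norm_nonneg _)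
    exact pow_le_pow_of_le_one hδ.le hδ1 (Nat.lt_succ_iff.1 (Finset.mem_range.1 hi))
  have h2 : (1 / 4 + δ * M) ^ l.length * ‖(1 : R)‖ ≤ (1 / 2 : ℝ) ^ m * ‖(1 : R)‖ := by
    rw [hlen]
    gcongr
  exact le_of_mul_le_mul_left (h1.trans (hsum.trans (h2.trans hm))) (by positivity)

/-- In a submultiplicative setting, if all products of some fixed length have norm at most `1/2`,
then norms of products decay exponentially. -/
theorem exists_norm_prod_le_mul_pow {R : Type*} [NormedRing R] {𝒜 : Set R} {K : ℝ}
    (hK : ∀ a ∈ 𝒜, ‖a‖ ≤ K) {N : ℕ} (hN : 1 ≤ N)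
    (h : ∀ l : List R, l.length = N → (∀ a ∈ l, a ∈ 𝒜) → ‖l.prod‖ ≤ 1 / 2) :
    ∃ C ρ : ℝ, 0 ≤ ρ ∧ ρ < 1 ∧
      ∀ l : List R, (∀ a ∈ l, a ∈ 𝒜) → ‖l.prod‖ ≤ C * ρ ^ l.length := by
  set K' : ℝ := max K 1
  have hK'1 : 1 ≤ K' := le_max_right _ _
  have hbound : ∀ l : List R, (∀ a ∈ l, a ∈ 𝒜) → ‖l.prod‖ ≤ K' ^ l.length * ‖(1 : R)‖ := by
    intro l hl
    induction l with
    | nil => simp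
    | cons a l ih =>
      rw [List.prod_cons, List.length_cons, pow_succ', mul_assoc]
      exact (norm_mul_le _ _).trans (mul_le_mul ((hK a (hl a List.mem_cons_self)).trans
        (le_max_left _ _)) (ih fun x hx => hl x (List.mem_cons_of_mem a hx)) (norm_nonneg _)
        (by positivity))
  set ρ : ℝ := (1 / 2 : ℝ) ^ ((N : ℝ)⁻¹)
  have hρ0 : 0 < ρ := by positivity
  have hρ1 : ρ < 1 := Real.rpow_lt_one (by norm_num) (by norm_num) (by positivity)
  have hρN : ρ ^ N = 1 / 2 := Real.rpow_inv_natCast_pow (by norm_num) (by omega)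
  -- The factor 2 covers the leftover block of length `n < N`, for which `ρ ^ n ≥ 1/2`.
  set C : ℝ := 2 * (K' ^ N * ‖(1 : R)‖)
  refine ⟨C, ρ, hρ0.le, hρ1, fun l => ?_⟩
  induction hlen : l.length using Nat.strong_induction_on generalizing l with
  | _ n ih =>
  intro hl
  rcases lt_or_ge n N with hn | hn
  · have h1 : (1 / 2 : ℝ) ≤ ρ ^ n := hρN ▸ pow_le_pow_of_le_one hρ0.le hρ1.le hn.le
    have h2 : K' ^ n * ‖(1 : R)‖ ≤ K' ^ N * ‖(1 : R)‖ := by gcongr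
    have h3 : 0 ≤ K' ^ N * ‖(1 : R)‖ := by positivity
    have h4 := hbound l hl
    rw [hlen] at h4
    calc ‖l.prod‖ ≤ K' ^ N * ‖(1 : R)‖ := h4.trans h2
      _ = C * (1 / 2) := by ring
      _ ≤ C * ρ ^ n := mul_le_mul_of_nonneg_left h1 (by positivity)
  · have h1 := h (l.take N) (by rw [List.length_take]; omega) fun a ha => hl a (List.mem_of_mem_take ha)
    have h2 := ih (n - N) (by omega) (l.drop N) (by rw [List.length_drop]; omega)
      fun a ha => hl a (List.mem_of_mem_drop ha)
    rw [← List.prod_take_mul_prod_drop l N]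
    calc _ ≤ 1 / 2 * (C * ρ ^ (n - N)) := (norm_mul_le _ _).trans
            (mul_le_mul h1 h2 (norm_nonneg _) (by norm_num))
      _ = C * (ρ ^ N * ρ ^ (n - N)) := by rw [hρN]; ring
      _ = C * ρ ^ n := by rw [← pow_add, Nat.add_sub_cancel' hn]

/-! ### The Berger–Wang inequality through the trace form. -/

open scoped Pointwise in
/-- If a trace-like functional detects nilpotency and decays exponentially along products of
elements of a bounded generating set of a finite-dimensional algebra, then the products of some
fixed length are small. -/
theorem exists_norm_prod_le_half_of_trace_of_adjoin_eq_top {R : Type*} [NormedRing R] [NormedAlgebra ℝ R]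
    [FiniteDimensional ℝ R] (τ : R →ₗ[ℝ] ℝ) (hcomm : ∀ x y, τ (x * y) = τ (y * x))
    (hnil : ∀ x, (∀ n : ℕ, τ (x ^ (n + 1)) = 0) → IsNilpotent x)
    {𝒜 : Set R} (hgen : Algebra.adjoin ℝ 𝒜 = ⊤) {K : ℝ} (hK : ∀ a ∈ 𝒜, ‖a‖ ≤ K)
    {c σ : ℝ} (hc : 0 ≤ c) (hσ0 : 0 ≤ σ) (hσ1 : σ < 1) {T : ℕ}
    (htr : ∀ t, T ≤ t → ∀ a ∈ 𝒜 ^ t, |τ a| ≤ c * σ ^ t) :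
    ∃ N : ℕ, 1 ≤ N ∧ ∀ l : List R, l.length = N → (∀ a ∈ l, a ∈ 𝒜) → ‖l.prod‖ ≤ 1 / 2 := by
  -- The radical of the form `(x, y) ↦ τ (x * y)`. It is two-sided because `τ` is tracial, and nil
  -- by `hnil`.
  let J : Ideal R :=
    { carrier := {x | ∀ y, τ (x * y) = 0}
      add_mem' := fun {x x'} hx hx' y => by rw [add_mul, map_add, hx, hx', add_zero]
      zero_mem' := fun y => by rw [zero_mul, map_zero]
      smul_mem' := fun z x hx y => by
        rw [smul_eq_mul, mul_assoc, hcomm, mul_assoc]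
        exact hx _ }
  have hJmem (x : R) : x ∈ J ↔ ∀ y, τ (x * y) = 0 := Iff.rfl
  have : J.IsTwoSided := ⟨fun {x} z hx y => by rw [mul_assoc]; exact hx _⟩
  have : IsArtinianRing R := IsArtinianRing.of_finite ℝ R
  obtain ⟨d, hd⟩ := J.exists_pow_eq_bot_of_forall_isNilpotent fun x hx => by
    obtain ⟨k, hk⟩ := hnil (x ^ 2) fun n => by
      rw [← pow_mul, show 2 * (n + 1) = (2 * n + 1) + 1 by ring, pow_succ']
      exact hx _
    exact ⟨2 * k, by rw [pow_mul, hk]⟩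
  let φ : R → Module.Dual ℝ R := fun s => τ ∘ₗ LinearMap.mulRight ℝ s
  have hφ (s x : R) : φ s x = τ (x * s) := rfl
  -- The constant `C` is uniform over the infinite family `x ↦ τ (x * s)`, with `s` in the monoid
  -- generated by `𝒜`. This monoid spans `R`, so the common kernel of the family is `J`.
  obtain ⟨C, hC, happ⟩ := exists_forall_exists_norm_sub_le_of_functionals
    (φ '' (Submonoid.closure 𝒜 : Set R))
  have hclosure : ∀ s ∈ Submonoid.closure 𝒜, ∃ n, s ∈ 𝒜 ^ n := by
    intro s hs
    induction hs using Submonoid.closure_induction with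
    | mem x hx => exact ⟨1, by simpa using hx⟩
    | one => exact ⟨0, by simp⟩
    | mul x y _ _ hx hy =>
      obtain ⟨m, hm⟩ := hx
      obtain ⟨n, hn⟩ := hy
      exact ⟨m + n, by rw [pow_add]; exact Set.mul_mem_mul hm hn⟩
  have hnear : ∀ t, T ≤ t → ∀ a ∈ 𝒜 ^ t, ∃ j ∈ J, ‖a - j‖ ≤ C * (c * σ ^ t) := by
    intro t ht a ha
    obtain ⟨j, hj, hja⟩ := happ a (c * σ ^ t) (by positivity) (by
      rintro _ ⟨s, hs, rfl⟩
      obtain ⟨m, hm⟩ := hclosure s hs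
      refine (htr (t + m) (by omega) (a * s) ?_).trans ?_
      · rw [pow_add]
        exact Set.mul_mem_mul ha hm
      · exact mul_le_mul_of_nonneg_left
          (pow_le_pow_of_le_one hσ0 hσ1.le (Nat.le_add_right t m)) hc)
    refine ⟨j, ?_, hja⟩
    rw [hJmem]
    have hle : Submodule.span ℝ (Submonoid.closure 𝒜 : Set R)
        ≤ LinearMap.ker (τ ∘ₗ LinearMap.mulLeft ℝ j) := by
      rw [Submodule.span_le]
      intro s hs
      exact hj _ ⟨s, hs, rfl⟩
    rw [← Algebra.adjoin_eq_span, hgen] at hle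
    exact fun y => hle (Submodule.mem_top : y ∈ (⊤ : Submodule ℝ R))
  have htend : Filter.Tendsto (fun t : ℕ => C * (c * σ ^ t)) Filter.atTop (nhds 0) := by
    simpa using ((tendsto_pow_atTop_nhds_zero_of_lt_one hσ0 hσ1).const_mul c).const_mul C
  obtain ⟨n, hn, hnsmall⟩ := ((Filter.eventually_ge_atTop (max T 1)).and
    (htend.eventually_le_const (show (0 : ℝ) < 1 / 4 by norm_num))).exists
  have hpowbound : ∀ t : ℕ, ∃ M : ℝ, 0 ≤ M ∧ ∀ a ∈ 𝒜 ^ t, ‖a‖ ≤ M := by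
    intro t
    induction t with
    | zero => exact ⟨‖(1 : R)‖, norm_nonneg _, by simp⟩
    | succ t ih =>
      obtain ⟨M, hM, h⟩ := ih
      refine ⟨M * max K 0, by positivity, ?_⟩
      rw [pow_succ]
      rintro _ ⟨x, hx, y, hy, rfl⟩
      exact (norm_mul_le _ _).trans (mul_le_mul (h x hx) ((hK y hy).trans (le_max_left _ _))
        (norm_nonneg _) hM)
  obtain ⟨M, hM, hMbound⟩ := hpowbound n
  obtain ⟨m, hm, hmain⟩ := J.exists_norm_prod_le_half hd (M := M + 1 / 4) (by positivity)
  refine ⟨n * m, Nat.mul_pos (by omega) hm, fun l hlen hl => ?_⟩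
  have hmem : l.prod ∈ (𝒜 ^ n) ^ m := by
    rw [← pow_mul, ← hlen]
    clear hlen
    induction l with
    | nil => simp
    | cons a l ih =>
      rw [List.prod_cons, List.length_cons, pow_succ']
      exact Set.mul_mem_mul (hl a List.mem_cons_self)
        (ih fun x hx => hl x (List.mem_cons_of_mem a hx))
  obtain ⟨f, hf⟩ := Set.mem_pow.1 hmem
  -- The word is read as `m` blocks of length `n`, each within `1/4` of `J`.
  rw [← hf]
  refine hmain _ (by simp) fun b hb => ?_
  obtain ⟨i, rfl⟩ := List.mem_ofFn.1 hb
  obtain ⟨j, hj, hij⟩ := hnear n (by omega) _ (f i).2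
  refine ⟨j, hj, hij.trans hnsmall, ?_⟩
  have h1 := norm_sub_norm_le j (f i : R)
  rw [norm_sub_rev] at h1
  linarith [hMbound _ (f i).2]

open scoped Pointwise in
/-- If the joint spectral radius of a set of matrices is less than one, then the traces of the
products decay exponentially. -/
theorem exists_abs_trace_le_of_jointSpectralRadius_lt_one {ι : Type*} [Fintype ι] [DecidableEq ι]
    {𝒜 : Set (Matrix ι ι ℝ)} (h : jointSpectralRadius 𝒜 < 1) :
    ∃ (σ : ℝ) (T : ℕ), 0 ≤ σ ∧ σ < 1 ∧
      ∀ t, T ≤ t → ∀ A ∈ 𝒜 ^ t, |A.trace| ≤ Fintype.card ι * σ ^ t := by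
  obtain ⟨σ, hσ, hσ1⟩ := ENNReal.lt_iff_exists_nnreal_btwn.1 h
  obtain ⟨T, hT⟩ := Filter.eventually_atTop.1 (Filter.eventually_lt_of_limsup_lt hσ)
  -- Length zero is excluded because the exponent `t⁻¹` is `0` there and says nothing about the
  -- spectral radius.
  refine ⟨σ, max T 1, σ.2, by exact_mod_cast hσ1, ?_⟩
  intro t ht A hA
  have h1 : spectralRadius ℂ (A.map (algebraMap ℝ ℂ)) ^ ((t : ℝ)⁻¹) ≤ σ :=
    (le_iSup₂ (f := fun (B : Matrix ι ι ℝ) (_ : B ∈ 𝒜 ^ t) =>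
      spectralRadius ℂ (B.map (algebraMap ℝ ℂ)) ^ ((t : ℝ)⁻¹)) A hA).trans (hT t (by omega)).le
  have ht0 : (0 : ℝ) < t := by
    have : 0 < t := by omega
    exact_mod_cast this
  have h2 : spectralRadius ℂ (A.map (algebraMap ℝ ℂ)) ≤ (σ : ENNReal) ^ t := by
    have := ENNReal.rpow_le_rpow h1 ht0.le
    rwa [← ENNReal.rpow_mul, inv_mul_cancel₀ ht0.ne', ENNReal.rpow_one,
      ENNReal.rpow_natCast] at this
  have h3 : ∀ z ∈ (A.map (algebraMap ℝ ℂ)).charpoly.roots, ‖z‖ ≤ (σ : ℝ) ^ t := by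
    intro z hz
    have hz' : z ∈ spectrum ℂ (A.map (algebraMap ℝ ℂ)) :=
      Matrix.mem_spectrum_of_isRoot_charpoly (Polynomial.isRoot_of_mem_roots hz)
    have h4 : (‖z‖₊ : ENNReal) ≤ (σ : ENNReal) ^ t :=
      (le_iSup₂ (f := fun (k : ℂ) (_ : k ∈ spectrum ℂ (A.map (algebraMap ℝ ℂ))) =>
        (‖k‖₊ : ENNReal)) z hz').trans h2
    exact_mod_cast h4
  have h5 : ‖(A.map (algebraMap ℝ ℂ)).trace‖ = |A.trace| := by
    have : (A.map (algebraMap ℝ ℂ)).trace = ((A.trace : ℝ) : ℂ) :=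
      (AddMonoidHom.map_trace (algebraMap ℝ ℂ) A).symm
    rw [this, Complex.norm_real, Real.norm_eq_abs]
  rw [← h5, Matrix.trace_eq_sum_roots_charpoly]
  have h6 : ∀ s : Multiset ℂ, (∀ z ∈ s, ‖z‖ ≤ (σ : ℝ) ^ t) →
      ‖s.sum‖ ≤ s.card * (σ : ℝ) ^ t := by
    intro s hs
    induction s using Multiset.induction_on with
    | empty => simp
    | cons a s ih =>
      rw [Multiset.sum_cons, Multiset.card_cons, Nat.cast_succ, add_mul, one_mul, add_comm]
      exact (norm_add_le _ _).trans (add_le_add (ih fun z hz => hs z (Multiset.mem_cons_of_mem hz))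
        (hs a (Multiset.mem_cons_self a s)))
  refine (h6 _ h3).trans (mul_le_mul_of_nonneg_right ?_ (by positivity))
  have := Polynomial.card_roots' (A.map (algebraMap ℝ ℂ)).charpoly
  rw [Matrix.charpoly_natDegree_eq_dim] at this
  exact_mod_cast this

open scoped Pointwise in
/-- If a trace-like functional detects nilpotency and decays exponentially along products of
elements of a bounded subset of a finite-dimensional algebra, then the products of some
fixed length are small. -/
theorem exists_norm_prod_le_half_of_trace {R : Type*} [NormedRing R] [NormedAlgebra ℝ R]
    [FiniteDimensional ℝ R] (τ : R →ₗ[ℝ] ℝ) (hcomm : ∀ x y, τ (x * y) = τ (y * x))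
    (hnil : ∀ x, (∀ n : ℕ, τ (x ^ (n + 1)) = 0) → IsNilpotent x)
    {𝒜 : Set R} {K : ℝ} (hK : ∀ a ∈ 𝒜, ‖a‖ ≤ K)
    {c σ : ℝ} (hc : 0 ≤ c) (hσ0 : 0 ≤ σ) (hσ1 : σ < 1) {T : ℕ}
    (htr : ∀ t, T ≤ t → ∀ a ∈ 𝒜 ^ t, |τ a| ≤ c * σ ^ t) :
    ∃ N : ℕ, 1 ≤ N ∧ ∀ l : List R, l.length = N → (∀ a ∈ l, a ∈ 𝒜) → ‖l.prod‖ ≤ 1 / 2 := by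
  have hpow : ∀ (t : ℕ), ∀ a ∈ (Subtype.val ⁻¹' 𝒜 : Set (Algebra.adjoin ℝ 𝒜)) ^ t,
      (a : R) ∈ 𝒜 ^ t := by
    intro t
    induction t with
    | zero => simp
    | succ t ih =>
      simp only [pow_succ]
      rintro _ ⟨x, hx, y, hy, rfl⟩
      exact Set.mul_mem_mul (ih x hx) hy
  -- All hypotheses pass to the subalgebra generated by `𝒜`, where the generation assumption holds
  -- automatically.
  obtain ⟨N, hN, hhalf⟩ := exists_norm_prod_le_half_of_trace_of_adjoin_eq_top
    (τ ∘ₗ (Algebra.adjoin ℝ 𝒜).val.toLinearMap) (fun x y => hcomm x y)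
    (fun x hx => by
      obtain ⟨n, hn⟩ := hnil x fun n => hx n
      exact ⟨n, Subtype.ext hn⟩)
    Algebra.adjoin_adjoin_coe_preimage (K := K) (fun a ha => hK a ha) hc hσ0 hσ1
    (fun t ht a ha => htr t ht a (hpow t a ha))
  refine ⟨N, hN, fun l hlen hl => ?_⟩
  lift l to List (Algebra.adjoin ℝ 𝒜) using fun A hA => Algebra.subset_adjoin (hl A hA)
  have h1 := hhalf l (by simpa using hlen) fun a ha => hl a (List.mem_map_of_mem ha)
  have h2 : (l.map Subtype.val).prod = (l.prod : R) :=
    (map_list_prod (Algebra.adjoin ℝ 𝒜).val l).symm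
  rw [h2]
  exact h1

/-- The Berger–Wang inequality for matrices: if the joint spectral radius, defined through the
spectral radii of products, of a bounded set of matrices is less than one, then the norms of the
products decay exponentially. -/
theorem exists_norm_prod_le_of_jointSpectralRadius_lt_one {ι : Type*} [Fintype ι] [DecidableEq ι]
    {𝒜 : Set (Matrix ι ι ℝ)} {K : ℝ} (hK : ∀ A ∈ 𝒜, ‖A‖ ≤ K)
    (h : jointSpectralRadius 𝒜 < 1) :
    ∃ C ρ : ℝ, 0 ≤ ρ ∧ ρ < 1 ∧
      ∀ l : List (Matrix ι ι ℝ), (∀ A ∈ l, A ∈ 𝒜) → ‖l.prod‖ ≤ C * ρ ^ l.length := by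
  obtain ⟨σ, T, hσ0, hσ1, htr⟩ := exists_abs_trace_le_of_jointSpectralRadius_lt_one h
  obtain ⟨N, hN, hhalf⟩ := exists_norm_prod_le_half_of_trace (Matrix.traceLinearMap ι ℝ ℝ)
    Matrix.trace_mul_comm Matrix.isNilpotent_of_forall_trace_pow_eq_zero hK
    (Nat.cast_nonneg (Fintype.card ι)) hσ0 hσ1 htr
  exact exists_norm_prod_le_mul_pow hK hN hhalf

/-! ### Global inversion under the gradient restriction. -/

/-- The Euclidean operator norm controls `A *ᵥ v` in the supremum norm, up to a constant. -/
theorem Matrix.exists_norm_mulVec_le (m n : Type*) [Fintype m] [Fintype n] [DecidableEq n] :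
    ∃ c : ℝ, 0 ≤ c ∧ ∀ (A : Matrix m n ℝ) (v : n → ℝ), ‖A *ᵥ v‖ ≤ c * ‖A‖ * ‖v‖ := by
  let e₁ := (PiLp.continuousLinearEquiv 2 ℝ (fun _ : m => ℝ)).toContinuousLinearMap
  let e₂ := (PiLp.continuousLinearEquiv 2 ℝ (fun _ : n => ℝ)).symm.toContinuousLinearMap
  refine ⟨‖e₁‖ * ‖e₂‖, by positivity, fun A v => ?_⟩
  calc ‖A *ᵥ v‖ = ‖e₁ (WithLp.toLp 2 (A *ᵥ v))‖ := rfl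
    _ ≤ ‖e₁‖ * (‖A‖ * (‖e₂‖ * ‖v‖)) := by
      refine (e₁.le_opNorm _).trans (mul_le_mul_of_nonneg_left ?_ (norm_nonneg _))
      refine (Matrix.l2_opNorm_mulVec A (WithLp.toLp 2 v)).trans
        (mul_le_mul_of_nonneg_left ?_ (norm_nonneg _))
      exact e₂.le_opNorm v
    _ = _ := by ring

theorem Matrix.l2_opNorm_transpose {m n : Type*} [Fintype m] [Fintype n] [DecidableEq m]
    [DecidableEq n] (A : Matrix m n ℝ) : ‖Aᵀ‖ = ‖A‖ := by
  rw [← Matrix.conjTranspose_eq_transpose_of_trivial, Matrix.l2_opNorm_conjTranspose]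

section GradientRestriction

variable {ι κ ν : Type*} [Fintype ι] [Fintype κ] [Fintype ν] [DecidableEq κ] [DecidableEq ν]

/-- If products of matrices decay in norm, so do they as operators for the supremum norm. -/
theorem Matrix.exists_norm_prod_mulVec_le {𝒜 : Set (Matrix κ κ ℝ)} {C ρ : ℝ}
    (hρ0 : 0 ≤ ρ) (hρ1 : ρ < 1)
    (hdecay : ∀ l : List (Matrix κ κ ℝ), (∀ A ∈ l, A ∈ 𝒜) → ‖l.prod‖ ≤ C * ρ ^ l.length) :
    ∃ (D : ℝ) (N : ℕ), 0 ≤ D ∧ ∀ l : List (Matrix κ κ ℝ), (∀ A ∈ l, A ∈ 𝒜) →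
      ∀ v : κ → ℝ, ‖l.prod *ᵥ v‖ ≤ D * ‖v‖ ∧ (l.length = N → ‖l.prod *ᵥ v‖ ≤ 1 / 2 * ‖v‖) := by
  obtain ⟨c, hc, hcmul⟩ := Matrix.exists_norm_mulVec_le κ κ
  have hC : 0 ≤ C := by
    have := hdecay [] (by simp)
    rw [List.length_nil, pow_zero, mul_one] at this
    exact (norm_nonneg _).trans this
  have htend : Filter.Tendsto (fun n : ℕ => c * (C * ρ ^ n)) Filter.atTop (nhds 0) := by
    simpa using ((tendsto_pow_atTop_nhds_zero_of_lt_one hρ0 hρ1).const_mul C).const_mul c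
  obtain ⟨N, hN⟩ := (htend.eventually_le_const (show (0 : ℝ) < 1 / 2 by norm_num)).exists
  refine ⟨c * C, N, by positivity, fun l hl v => ?_⟩
  have h1 : ‖l.prod *ᵥ v‖ ≤ c * (C * ρ ^ l.length) * ‖v‖ :=
    (hcmul _ v).trans (mul_le_mul_of_nonneg_right
      (mul_le_mul_of_nonneg_left (hdecay l hl) hc) (norm_nonneg _))
  refine ⟨h1.trans ?_, fun hlen => h1.trans ?_⟩
  · refine mul_le_mul_of_nonneg_right (mul_le_mul_of_nonneg_left ?_ hc) (norm_nonneg _)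
    exact mul_le_of_le_one_right hC (pow_le_one₀ hρ0 hρ1.le)
  · rw [hlen]
    exact mul_le_mul_of_nonneg_right hN (norm_nonneg _)

/-- If the increments of `G` are `G x - G y = βᵀ (x - y)` with `β` in a bounded set `ℬ`, and the
products of the matrices `1 + βᵀ a` decay, then `x` depends in a Lipschitz way on `(P x, G x)`, for
every linear surjection `P` whose kernel is the range of `a`. -/
theorem exists_norm_sub_le_of_gradient_restriction [DecidableEq ι] {G : (ι → ℝ) → κ → ℝ} {a : Matrix ι κ ℝ}
    {ℬ : Set (Matrix ι κ ℝ)} {b : ℝ} (hb : ∀ β ∈ ℬ, ‖β‖ ≤ b)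
    (hG : ∀ x y, ∃ β ∈ ℬ, G x - G y = βᵀ *ᵥ (x - y)) {C ρ : ℝ} (hρ0 : 0 ≤ ρ) (hρ1 : ρ < 1)
    (hdecay : ∀ l : List (Matrix κ κ ℝ), (∀ A ∈ l, A ∈ {A | ∃ β ∈ ℬ, A = 1 + βᵀ * a}) →
      ‖l.prod‖ ≤ C * ρ ^ l.length)
    {P : Matrix ν ι ℝ} {R : Matrix ι ν ℝ} (hPR : P * R = 1)
    (hker : ∀ x, P *ᵥ x = 0 → ∃ w, x = a *ᵥ w) :
    ∃ K : ℝ, 0 ≤ K ∧ ∀ x y, ‖x - y‖ ≤ K * (‖P *ᵥ x - P *ᵥ y‖ + ‖G x - G y‖) := by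
  obtain ⟨D, N, hD, hDN⟩ := Matrix.exists_norm_prod_mulVec_le hρ0 hρ1 hdecay
  obtain ⟨c₁, hc₁, hmul₁⟩ := Matrix.exists_norm_mulVec_le κ ι
  obtain ⟨c₂, hc₂, hmul₂⟩ := Matrix.exists_norm_mulVec_le ι ν
  obtain ⟨c₃, hc₃, hmul₃⟩ := Matrix.exists_norm_mulVec_le ι κ
  set L : ℝ := c₁ * |b| * (c₂ * ‖R‖) + 1
  set M : ℝ := 2 * (N * D) * L
  refine ⟨c₂ * ‖R‖ + c₃ * ‖a‖ * M, by positivity, fun x y => ?_⟩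
  set δ := P *ᵥ x - P *ᵥ y
  set γ := G x - G y with hγ
  obtain ⟨β, hβ, hβG⟩ := hG x y
  obtain ⟨w, hw⟩ := hker (x - y - R *ᵥ δ) (by
    rw [mulVec_sub, mulVec_sub, mulVec_mulVec, hPR, one_mulVec, sub_self])
  have hxy : x - y = R *ᵥ δ + a *ᵥ w := by rw [← hw]; abel
  set A := 1 + βᵀ * a with hA
  set e := βᵀ *ᵥ (R *ᵥ δ) - γ with he
  -- Writing `x - y = R δ + a w` turns `γ = βᵀ (x - y)` into a fixed-point equation for `w`. After
  -- `N` iterations `‖A ^ N *ᵥ w‖ ≤ ‖w‖ / 2`, which bounds `‖w‖` by `2 * N * D * ‖e‖`. Only powers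
  -- of one matrix occur here.
  have hfix : w = A *ᵥ w + e := by
    rw [he, hγ, hβG, hxy, hA, add_mulVec, one_mulVec, mulVec_add, mulVec_mulVec w]
    abel
  have hpow : ∀ n : ℕ, ∀ v, ‖A ^ n *ᵥ v‖ ≤ D * ‖v‖ ∧ (n = N → ‖A ^ n *ᵥ v‖ ≤ 1 / 2 * ‖v‖) := by
    intro n v
    have := hDN (List.replicate n A) (fun B hB => ⟨β, hβ, (List.eq_of_mem_replicate hB).trans hA⟩) v
    rwa [List.prod_replicate, List.length_replicate] at this
  have hiter : ∀ n : ℕ, ‖w - A ^ n *ᵥ w‖ ≤ n * D * ‖e‖ := by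
    intro n
    induction n with
    | zero => simp
    | succ n ih =>
      have h1 : w - A ^ (n + 1) *ᵥ w = (w - A ^ n *ᵥ w) + A ^ n *ᵥ e := by
        conv_lhs => rw [pow_succ, ← mulVec_mulVec, ← sub_eq_of_eq_add hfix]
        rw [mulVec_sub]
        abel
      rw [h1]
      refine (norm_add_le _ _).trans ((add_le_add ih (hpow n e).1).trans (le_of_eq ?_))
      push_cast
      ring
  have he' : ‖e‖ ≤ L * (‖δ‖ + ‖γ‖) := by
    have h1 : ‖R *ᵥ δ‖ ≤ c₂ * ‖R‖ * ‖δ‖ := hmul₂ R δ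
    have h2 : ‖βᵀ *ᵥ (R *ᵥ δ)‖ ≤ c₁ * |b| * (c₂ * ‖R‖ * ‖δ‖) := by
      refine (hmul₁ _ _).trans (mul_le_mul (mul_le_mul_of_nonneg_left ?_ hc₁) h1 (norm_nonneg _)
        (by positivity))
      rw [Matrix.l2_opNorm_transpose]
      exact (hb β hβ).trans (le_abs_self b)
    have h3 : 0 ≤ c₁ * |b| * (c₂ * ‖R‖) * ‖γ‖ := by positivity
    calc ‖e‖ ≤ c₁ * |b| * (c₂ * ‖R‖ * ‖δ‖) + ‖γ‖ := (norm_sub_le _ _).trans (add_le_add_left h2 _)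
      _ ≤ c₁ * |b| * (c₂ * ‖R‖ * ‖δ‖) + ‖γ‖ + (c₁ * |b| * (c₂ * ‖R‖) * ‖γ‖ + ‖δ‖) :=
        le_add_of_nonneg_right (by positivity)
      _ = L * (‖δ‖ + ‖γ‖) := by ring
  have hwle : ‖w‖ ≤ M * (‖δ‖ + ‖γ‖) := by
    have h1 := (hpow N w).2 rfl
    have h2 := norm_sub_norm_le w (A ^ N *ᵥ w)
    have h3 : N * D * ‖e‖ ≤ N * D * (L * (‖δ‖ + ‖γ‖)) :=
      mul_le_mul_of_nonneg_left he' (by positivity)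
    calc ‖w‖ ≤ 2 * (N * D * (L * (‖δ‖ + ‖γ‖))) := by linarith [hiter N]
      _ = M * (‖δ‖ + ‖γ‖) := by ring
  rw [hxy]
  have h4 : c₂ * ‖R‖ * ‖δ‖ ≤ c₂ * ‖R‖ * (‖δ‖ + ‖γ‖) :=
    mul_le_mul_of_nonneg_left (le_add_of_nonneg_right (norm_nonneg _)) (by positivity)
  have h5 : c₃ * ‖a‖ * ‖w‖ ≤ c₃ * ‖a‖ * (M * (‖δ‖ + ‖γ‖)) :=
    mul_le_mul_of_nonneg_left hwle (by positivity)
  calc ‖R *ᵥ δ + a *ᵥ w‖ ≤ c₂ * ‖R‖ * ‖δ‖ + c₃ * ‖a‖ * ‖w‖ :=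
        (norm_add_le _ _).trans (add_le_add (hmul₂ R δ) (hmul₃ a w))
    _ ≤ _ := by rw [add_mul, mul_assoc (c₃ * ‖a‖)]; exact add_le_add h4 h5

/-- Under the same restriction, the equations `P x = q`, `G x = m` are solvable: the map
`w ↦ w + G (R q + a w) - m` has a contracting iterate. -/
theorem exists_solution_of_gradient_restriction {G : (ι → ℝ) → κ → ℝ} {a : Matrix ι κ ℝ}
    {ℬ : Set (Matrix ι κ ℝ)}
    (hG : ∀ x y, ∃ β ∈ ℬ, G x - G y = βᵀ *ᵥ (x - y)) {C ρ : ℝ} (hρ0 : 0 ≤ ρ) (hρ1 : ρ < 1)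
    (hdecay : ∀ l : List (Matrix κ κ ℝ), (∀ A ∈ l, A ∈ {A | ∃ β ∈ ℬ, A = 1 + βᵀ * a}) →
      ‖l.prod‖ ≤ C * ρ ^ l.length)
    {P : Matrix ν ι ℝ} {R : Matrix ι ν ℝ} (hPR : P * R = 1) (hPa : P * a = 0)
    (q : ν → ℝ) (m : κ → ℝ) : ∃ x, P *ᵥ x = q ∧ G x = m := by
  obtain ⟨D, N, -, hDN⟩ := Matrix.exists_norm_prod_mulVec_le hρ0 hρ1 hdecay
  let T : (κ → ℝ) → κ → ℝ := fun w => w + G (R *ᵥ q + a *ᵥ w) - m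
  have hT : ∀ w w', ∃ A ∈ {A | ∃ β ∈ ℬ, A = 1 + βᵀ * a}, T w - T w' = A *ᵥ (w - w') := by
    intro w w'
    obtain ⟨β, hβ, h⟩ := hG (R *ᵥ q + a *ᵥ w) (R *ᵥ q + a *ᵥ w')
    refine ⟨_, ⟨β, hβ, rfl⟩, ?_⟩
    have h1 : T w - T w' = (w - w') + (G (R *ᵥ q + a *ᵥ w) - G (R *ᵥ q + a *ᵥ w')) := by
      simp only [T]
      abel
    rw [h1, h, add_sub_add_left_eq_sub, ← mulVec_sub, mulVec_mulVec, add_mulVec, one_mulVec]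
  -- Each iteration may bring a different `β`, so decay of mixed products is needed, not only of the
  -- powers of each matrix.
  have hiter : ∀ (n : ℕ) (w w' : κ → ℝ), ∃ l : List (Matrix κ κ ℝ), l.length = n ∧
      (∀ A ∈ l, A ∈ {A | ∃ β ∈ ℬ, A = 1 + βᵀ * a}) ∧
      T^[n] w - T^[n] w' = l.prod *ᵥ (w - w') := by
    intro n w w'
    induction n with
    | zero => exact ⟨[], rfl, by simp, by simp⟩
    | succ n ih =>
      obtain ⟨l, hlen, hl, hprod⟩ := ih
      obtain ⟨A, hA, hTA⟩ := hT (T^[n] w) (T^[n] w')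
      refine ⟨A :: l, by rw [List.length_cons, hlen], List.forall_mem_cons.2 ⟨hA, hl⟩, ?_⟩
      rw [Function.iterate_succ_apply', Function.iterate_succ_apply', hTA, hprod, List.prod_cons,
        mulVec_mulVec]
  have hcontr : ContractingWith (1 / 2 : NNReal) T^[N] := by
    refine ⟨by rw [div_lt_one two_pos]; exact one_lt_two, LipschitzWith.of_dist_le_mul fun w w' => ?_⟩
    obtain ⟨l, hlen, hl, hprod⟩ := hiter N w w'
    rw [dist_eq_norm, dist_eq_norm, hprod]
    exact ((hDN l hl (w - w')).2 hlen).trans (le_of_eq (by simp))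
  have hfix : T (ContractingWith.fixedPoint _ hcontr) = ContractingWith.fixedPoint _ hcontr :=
    hcontr.isFixedPt_fixedPoint_iterate
  set w := ContractingWith.fixedPoint _ hcontr
  refine ⟨R *ᵥ q + a *ᵥ w, ?_, ?_⟩
  · rw [mulVec_add, mulVec_mulVec, mulVec_mulVec, hPR, hPa, one_mulVec, zero_mulVec, add_zero]
  -- `T w = w` says exactly that `G (R q + a w) = m`.
  · simp only [T, add_sub_assoc, add_eq_left, sub_eq_zero] at hfix
    exact hfix

/-- Under the same restriction, `x ↦ (P x, G x)` is a bijection with continuous inverse. -/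
theorem exists_continuous_inverse_of_gradient_restriction [DecidableEq ι] {G : (ι → ℝ) → κ → ℝ}
    {a : Matrix ι κ ℝ} {ℬ : Set (Matrix ι κ ℝ)} {b : ℝ} (hb : ∀ β ∈ ℬ, ‖β‖ ≤ b)
    (hG : ∀ x y, ∃ β ∈ ℬ, G x - G y = βᵀ *ᵥ (x - y)) {C ρ : ℝ} (hρ0 : 0 ≤ ρ) (hρ1 : ρ < 1)
    (hdecay : ∀ l : List (Matrix κ κ ℝ), (∀ A ∈ l, A ∈ {A | ∃ β ∈ ℬ, A = 1 + βᵀ * a}) →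
      ‖l.prod‖ ≤ C * ρ ^ l.length)
    {P : Matrix ν ι ℝ} {R : Matrix ι ν ℝ} (hPR : P * R = 1) (hPa : P * a = 0)
    (hker : ∀ x, P *ᵥ x = 0 → ∃ w, x = a *ᵥ w) :
    ∃ F : (ν → ℝ) × (κ → ℝ) → ι → ℝ, Continuous F ∧
      (∀ q m, P *ᵥ F (q, m) = q ∧ G (F (q, m)) = m) ∧ ∀ x, F (P *ᵥ x, G x) = x := by
  obtain ⟨K, hK, hKle⟩ :=
    exists_norm_sub_le_of_gradient_restriction hb hG hρ0 hρ1 hdecay hPR hker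
  choose F hF using fun s : (ν → ℝ) × (κ → ℝ) =>
    exists_solution_of_gradient_restriction hG hρ0 hρ1 hdecay hPR hPa s.1 s.2
  refine ⟨F, ?_, fun q m => hF (q, m), fun x => ?_⟩
  · refine (LipschitzWith.of_dist_le_mul (K := (K * 2).toNNReal) fun s t => ?_).continuous
    have h := hKle (F s) (F t)
    rw [(hF s).1, (hF s).2, (hF t).1, (hF t).2] at h
    rw [dist_eq_norm, dist_eq_norm, Real.coe_toNNReal _ (by positivity), mul_assoc]
    refine h.trans (mul_le_mul_of_nonneg_left ?_ hK)
    rw [two_mul]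
    exact add_le_add (norm_fst_le (s - t)) (norm_snd_le (s - t))
  · have h := hKle (F (P *ᵥ x, G x)) x
    rw [(hF _).1, (hF _).2, sub_self, sub_self, norm_zero, norm_zero, add_zero, mul_zero] at h
    exact sub_eq_zero.1 (norm_le_zero_iff.1 h)

/-- The increments of `G` being `βᵀ (x - y)` with `β` bounded, `G` is continuous. -/
theorem continuous_of_gradient_restriction [DecidableEq ι] {G : (ι → ℝ) → κ → ℝ} {ℬ : Set (Matrix ι κ ℝ)} {b : ℝ}
    (hb : ∀ β ∈ ℬ, ‖β‖ ≤ b) (hG : ∀ x y, ∃ β ∈ ℬ, G x - G y = βᵀ *ᵥ (x - y)) :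
    Continuous G := by
  obtain ⟨c, hc, hmul⟩ := Matrix.exists_norm_mulVec_le κ ι
  refine (LipschitzWith.of_dist_le_mul (K := (c * |b|).toNNReal) fun x y => ?_).continuous
  obtain ⟨β, hβ, h⟩ := hG x y
  rw [dist_eq_norm, dist_eq_norm, h, Real.coe_toNNReal _ (by positivity)]
  refine (hmul _ _).trans (mul_le_mul_of_nonneg_right (mul_le_mul_of_nonneg_left ?_ hc)
    (norm_nonneg _))
  rw [Matrix.l2_opNorm_transpose]
  exact (hb β hβ).trans (le_abs_self b)

end GradientRestriction

/-! ### Ranks and the block matrices. -/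

theorem Matrix.exists_transpose_mul_eq_one_of_rank_eq {m n : ℕ} {A : Matrix (Fin m) (Fin n) ℝ}
    (h : A.rank = n) : ∃ B : Matrix (Fin m) (Fin n) ℝ, Aᵀ * B = 1 := by
  refine Matrix.mulVec_surjective_iff_exists_right_inverse.1 ?_
  have h1 : Module.finrank ℝ (LinearMap.range Aᵀ.mulVecLin) = Module.finrank ℝ (Fin n → ℝ) := by
    rw [Module.finrank_fin_fun]
    exact (Matrix.rank_transpose A).trans h
  exact LinearMap.range_eq_top.1 (Submodule.eq_top_of_finrank_eq h1)

/-- The kernel of `Bᵀ` is the range of `A` if `Bᵀ A = 0` and the ranks are complementary. -/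
theorem Matrix.exists_eq_mulVec_of_transpose_mulVec_eq_zero {m n q : ℕ}
    {A : Matrix (Fin m) (Fin n) ℝ} {B : Matrix (Fin m) (Fin q) ℝ} (hBA : Bᵀ * A = 0)
    (hrank : A.rank + B.rank = m) {v : Fin m → ℝ} (hv : Bᵀ *ᵥ v = 0) : ∃ w, v = A *ᵥ w := by
  have hle : LinearMap.range A.mulVecLin ≤ LinearMap.ker Bᵀ.mulVecLin := by
    rintro _ ⟨w, rfl⟩
    rw [LinearMap.mem_ker, mulVecLin_apply, mulVecLin_apply, mulVec_mulVec, hBA, zero_mulVec]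
  have hsum := LinearMap.finrank_range_add_finrank_ker Bᵀ.mulVecLin
  have hB : Module.finrank ℝ (LinearMap.range Bᵀ.mulVecLin) = B.rank := Matrix.rank_transpose B
  have hA : Module.finrank ℝ (LinearMap.range A.mulVecLin) = A.rank := rfl
  rw [Module.finrank_fin_fun, hB] at hsum
  have heq := Submodule.eq_of_le_of_finrank_eq hle (by omega)
  have hmem : v ∈ LinearMap.range A.mulVecLin := by
    rw [heq]
    exact hv
  obtain ⟨w, hw⟩ := hmem
  exact ⟨w, hw.symm⟩

theorem Finset.sum_Icc_one_eq_sum_range {M : Type*} [AddCommMonoid M] (n : ℕ) (F : ℕ → M) :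
    ∑ i ∈ Finset.Icc 1 n, F i = ∑ i ∈ Finset.range n, F (i + 1) := by
  induction n with
  | zero => simp
  | succ n ih => rw [Finset.sum_Icc_succ_top (by omega), ih, Finset.sum_range_succ]

/-- The `p × p(k-1)` matrix `[I_p, …, I_p]`. -/
def matBlockSum (p k : ℕ) : Matrix (Fin p) (LagIdx p k) ℝ :=
  Matrix.of fun a lb => if a = lb.2 then 1 else 0

theorem matD_mulVec_apply {p k : ℕ} (ζ : LagIdx p k → ℝ) (j : Fin (k - 1)) (a : Fin p) :
    (matD p k *ᵥ ζ) (j, a) =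
      -ζ (j, a) + if h : (j : ℕ) + 1 < k - 1 then ζ (⟨j + 1, h⟩, a) else 0 := by
  have h1 : (matD p k *ᵥ ζ) (j, a) = ∑ l : Fin (k - 1),
      ((if l = j then -ζ (j, a) else 0) + if (l : ℕ) = j + 1 then ζ (l, a) else 0) := by
    rw [mulVec, dotProduct, Fintype.sum_prod_type]
    refine Finset.sum_congr rfl fun l _ => ?_
    rw [Finset.sum_eq_single a]
    · simp only [matD, Matrix.of_apply, if_true]
      by_cases hl : l = j
      · subst hl
        simp
      · simp [hl]
    · intro c _ hc
      simp [matD, Ne.symm hc]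
    · simp
  rw [h1, Finset.sum_add_distrib, Finset.sum_ite_eq' Finset.univ j, if_pos (Finset.mem_univ j)]
  congr 1
  split_ifs with h
  · rw [Finset.sum_eq_single (⟨j + 1, h⟩ : Fin (k - 1))]
    · simp
    · intro l _ hl
      rw [if_neg fun h' => hl (Fin.ext h')]
    · simp
  · refine Finset.sum_eq_zero fun l _ => if_neg ?_
    have := l.2
    omega

theorem matE_transpose_mulVec_apply {p k : ℕ} (ζ : LagIdx p k → ℝ) (a : Fin p) :
    ((matE p k)ᵀ *ᵥ ζ) a = if h : 0 < k - 1 then ζ (⟨0, h⟩, a) else 0 := by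
  rw [mulVec, dotProduct, Fintype.sum_prod_type]
  have h1 : ∀ l : Fin (k - 1), ∑ c, (matE p k)ᵀ a (l, c) * ζ (l, c)
      = if (l : ℕ) = 0 then ζ (l, a) else 0 := by
    intro l
    rw [Finset.sum_eq_single a]
    · simp [matE]
    · intro c _ hc
      simp [matE, hc]
    · simp
  simp only [h1]
  split_ifs with h
  · rw [Finset.sum_eq_single (⟨0, h⟩ : Fin (k - 1))]
    · simp
    · intro l _ hl
      rw [if_neg fun h' => hl (Fin.ext h')]
    · simp
  · refine Finset.sum_eq_zero fun l _ => if_neg ?_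
    have := l.2
    omega

theorem matBlockSum_mulVec_apply {p k : ℕ} (ζ : LagIdx p k → ℝ) (a : Fin p) :
    (matBlockSum p k *ᵥ ζ) a = ∑ j : Fin (k - 1), ζ (j, a) := by
  rw [mulVec, dotProduct, Fintype.sum_prod_type]
  refine Finset.sum_congr rfl fun j _ => ?_
  simp [matBlockSum]

/-- Summing the blocks of `D ζ` telescopes to `-ζ_1`. -/
theorem matBlockSum_mulVec_matD_mulVec {p k : ℕ} (ζ : LagIdx p k → ℝ) :
    matBlockSum p k *ᵥ (matD p k *ᵥ ζ) = -((matE p k)ᵀ *ᵥ ζ) := by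
  ext a
  rw [matBlockSum_mulVec_apply, Pi.neg_apply, matE_transpose_mulVec_apply]
  simp only [matD_mulVec_apply]
  let F : ℕ → ℝ := fun i => if h : i < k - 1 then ζ (⟨i, h⟩, a) else 0
  have h1 : ∀ j : Fin (k - 1), (-ζ (j, a) +
      if h : (j : ℕ) + 1 < k - 1 then ζ (⟨j + 1, h⟩, a) else 0) = F (j + 1) - F j := by
    intro j
    simp only [F, j.2, dif_pos]
    ring
  have h2 : F (k - 1) = 0 := by simp [F]
  simp only [h1]
  rw [Fin.sum_univ_eq_sum_range fun i => F (i + 1) - F i, Finset.sum_range_sub, h2, zero_sub]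

theorem matD0_mulVec_elim {p k r : ℕ} (x : Vec p) (ζ : LagIdx p k → ℝ) :
    matD0 p k r *ᵥ Sum.elim x ζ = Sum.elim (0 : Vec r) (matD p k *ᵥ ζ) := by
  rw [matD0, fromBlocks_mulVec]
  simp

theorem alphaStack_mulVec_elim {p k r : ℕ} (α : Matrix (Fin p) (Fin r) ℝ) (v : Vec r)
    (w : LagIdx p k → ℝ) :
    alphaStack k α *ᵥ Sum.elim v w = Sum.elim (α *ᵥ v + (matE p k)ᵀ *ᵥ w) w := by
  rw [alphaStack, fromBlocks_mulVec]
  simp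

theorem stack_add {p r : ℕ} (hr : r ≤ p) (x x' : Vec (p - r)) (y y' : Vec r) :
    stack hr x y + stack hr x' y' = stack hr (x + x') (y + y') := by
  ext i
  simp only [stack, Pi.add_apply]
  cases (splitIdx hr).symm i <;> rfl

theorem continuous_stack {p r : ℕ} (hr : r ≤ p) :
    Continuous fun s : Vec (p - r) × Vec r => stack hr s.1 s.2 := by
  refine continuous_pi fun i => ?_
  simp only [stack]
  cases (splitIdx hr).symm i with
  | inl j => exact (continuous_apply j).comp continuous_fst
  | inr j => exact (continuous_apply j).comp continuous_snd

theorem stack_splitIdx {p r : ℕ} (hr : r ≤ p) (v : Vec p) :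
    stack hr (fun i => v (splitIdx hr (Sum.inl i))) (fun i => v (splitIdx hr (Sum.inr i))) = v := by
  ext i
  obtain ⟨s, rfl⟩ := (splitIdx hr).surjective i
  rw [stack, Equiv.symm_apply_apply]
  cases s <;> rfl

theorem stack_apply_splitIdx_inl {p r : ℕ} (hr : r ≤ p) (x : Vec (p - r)) (y : Vec r)
    (i : Fin (p - r)) : stack hr x y (splitIdx hr (Sum.inl i)) = x i := by
  rw [stack, Equiv.symm_apply_apply, Sum.elim_inl]

theorem stack_apply_splitIdx_inr {p r : ℕ} (hr : r ≤ p) (x : Vec (p - r)) (y : Vec r)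
    (i : Fin r) : stack hr x y (splitIdx hr (Sum.inr i)) = y i := by
  rw [stack, Equiv.symm_apply_apply, Sum.elim_inr]

theorem matS_mulVec_elim {p k r : ℕ} (hr : r ≤ p) (αperp : Matrix (Fin p) (Fin (p - r)) ℝ)
    (v : Vec r) (w : LagIdx p k → ℝ) :
    matS k hr αperp *ᵥ Sum.elim v w = stack hr (-(αperpᵀ *ᵥ (matBlockSum p k *ᵥ w))) v := by
  have h1 : ((Matrix.fromBlocks (-αperpᵀ) 0 0 1 :
        Matrix (Fin (p - r) ⊕ Fin r) (Fin p ⊕ Fin r) ℝ) *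
      (Matrix.fromBlocks 0 (matBlockSum p k) 1 0 :
        Matrix (Fin p ⊕ Fin r) (DevIdx p k r) ℝ)) *ᵥ Sum.elim v w
      = Sum.elim (-(αperpᵀ *ᵥ (matBlockSum p k *ᵥ w))) v := by
    rw [← mulVec_mulVec, fromBlocks_mulVec, fromBlocks_mulVec]
    simp [neg_mulVec]
  ext i
  exact congrFun h1 ((splitIdx hr).symm i)

/-! ### Algebra of the model: `ζ`, `h̄`, `𝛏` and `χ`. -/

namespace NonlinVAR

variable {p k r : ℕ} (V : NonlinVAR p k)

theorem matBlockSum_mulVec_gStack (x : Vec p) :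
    matBlockSum p k *ᵥ V.gStack x = ∑ i ∈ Finset.Icc 1 (k - 1), V.g i x := by
  ext a
  rw [matBlockSum_mulVec_apply, Finset.sum_apply, Finset.sum_Icc_one_eq_sum_range]
  exact Fin.sum_univ_eq_sum_range (fun j => V.g (j + 1) x a) (k - 1)

/-- `Δζ_t = 𝐠(z_t) + D ζ_{t-1}`. -/
theorem gStack_add_matD_mulVec_zeta (z : ℤ → Vec p) (t : ℤ) :
    V.gStack (z t) + matD p k *ᵥ V.zeta z (t - 1) = V.zeta z t - V.zeta z (t - 1) := by
  ext ⟨j, a⟩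
  have hj : (j : ℕ) + 1 ≤ k - 1 := j.2
  -- The recursion `ζ_{j,t} = g_j(z_t) + ζ_{j+1,t-1}`, in which the last block has no second term.
  have h1 : V.zeta z t (j, a) = V.gStack (z t) (j, a)
      + if h : (j : ℕ) + 1 < k - 1 then V.zeta z (t - 1) (⟨j + 1, h⟩, a) else 0 := by
    simp only [zeta, gStack]
    rw [← Finset.add_sum_Ioc_eq_sum_Icc hj]
    congr 1
    · congr 2
      ring
    · rw [← Finset.Icc_succ_left_eq_Ioc, Order.succ_eq_add_one]
      split_ifs with h
      · refine Finset.sum_congr rfl fun i _ => ?_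
        congr 2
        push_cast
        ring
      · rw [Finset.Icc_eq_empty (by omega), Finset.sum_empty]
  rw [Pi.add_apply, Pi.sub_apply, matD_mulVec_apply, h1]
  ring

theorem matE_transpose_mulVec_zeta (z : ℤ → Vec p) (t : ℤ) :
    (matE p k)ᵀ *ᵥ V.zeta z (t - 1) = ∑ i ∈ Finset.Icc 1 (k - 1), V.g i (z (t - (i : ℤ))) := by
  ext a
  rw [matE_transpose_mulVec_apply, Finset.sum_apply]
  split_ifs with h
  · simp only [zeta]
    refine Finset.sum_congr rfl fun i _ => ?_
    congr 2
    push_cast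
    ring
  · rw [Finset.Icc_eq_empty (by omega), Finset.sum_empty]

theorem hbar_eq (z : ℤ → Vec p) (t : ℤ) :
    V.hbar z t = V.f 0 (z t) - (matE p k)ᵀ *ᵥ V.zeta z (t - 1) := by
  rw [hbar, matE_transpose_mulVec_zeta]

theorem f_eq_g_sub_g {i : ℕ} (hi : i < k) (x : Vec p) : V.f (i + 1) x = V.g (i + 1) x - V.g i x := by
  rw [g, g, ← Finset.add_sum_Ioc_eq_sum_Icc (by omega : i + 1 ≤ k), ← Finset.Icc_succ_left_eq_Ioc,
    Order.succ_eq_add_one]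
  abel

variable {V}

/-- Summation by parts with `f_i = g_i - g_{i-1}` and `g_k = 0`: the sums over lags are absorbed
into `h̄`, and what remains is `-f_0 - g_0 = π` at `z_{t-1}`. -/
theorem Follows.hbar_sub_hbar (hk : 1 ≤ k) {z u : ℤ → Vec p} (hz : V.Follows z u) {t : ℤ}
    (ht : 1 ≤ t) : V.hbar z t - V.hbar z (t - 1) = V.c + V.piMap (z (t - 1)) + u t := by
  obtain ⟨n, rfl⟩ : ∃ n, k = n + 1 := ⟨k - 1, by omega⟩
  have hlast (x : Vec p) : V.g (n + 1) x = 0 := by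
    rw [g, Finset.Icc_eq_empty (by omega), Finset.sum_empty, neg_zero]
  have hzero (x : Vec p) : V.g 0 x = -∑ i ∈ Finset.Icc 1 (n + 1), V.f i x := rfl
  have hsum : ∑ i ∈ Finset.Icc 1 (n + 1), V.f i (z (t - (i : ℤ)))
      = ∑ i ∈ Finset.range n, V.g (i + 1) (z (t - ((i + 1 : ℕ) : ℤ)))
        - (∑ i ∈ Finset.range n, V.g (i + 1) (z (t - 1 - ((i + 1 : ℕ) : ℤ)))
          + V.g 0 (z (t - 1))) := by
    rw [Finset.sum_Icc_one_eq_sum_range, Finset.sum_congr rfl fun i hi =>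
      V.f_eq_g_sub_g (Finset.mem_range.1 hi) _, Finset.sum_sub_distrib, Finset.sum_range_succ, hlast,
      add_zero, Finset.sum_range_succ' (fun i => V.g i (z (t - ((i + 1 : ℕ) : ℤ))))]
    congr 2
    refine Finset.sum_congr rfl fun i _ => ?_
    congr 2
    push_cast
    ring
  rw [hbar, hbar, hz t ht, piMap, hsum, Nat.add_sub_cancel, Finset.sum_Icc_one_eq_sum_range n,
    Finset.sum_Icc_one_eq_sum_range n, hzero]
  abel

theorem xi_eq (V : NonlinVAR p k) (μ : Vec r) (θ : Vec p → Vec r) (z : ℤ → Vec p) (t : ℤ) :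
    V.xi μ θ z t = Sum.elim (μ + θ (z t)) (V.zeta z t - V.zeta z (t - 1)) := by
  rw [xi, state, thetaStack, matD0_mulVec_elim, ← gStack_add_matD_mulVec_zeta]
  ext (i | i) <;> simp

/-- `χ` in terms of the restricted and the gradient coordinates of `(f_0(x), ζ)`, for any `ζ`. -/
theorem chi_eq (V : NonlinVAR p k) (hr : r ≤ p) (αperp : Matrix (Fin p) (Fin (p - r)) ℝ)
    (θ : Vec p → Vec r) (x : Vec p) (ζ : LagIdx p k → ℝ) :
    V.chi hr αperp θ x = stack hr (αperpᵀ *ᵥ (V.f 0 x - (matE p k)ᵀ *ᵥ ζ)) 0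
      + matS k hr αperp *ᵥ (V.thetaStack θ x + matD0 p k r *ᵥ Sum.elim (V.f 0 x) ζ) := by
  -- The blocks of `D ζ` sum to `-Eᵀ ζ`, which cancels the `ζ` in the first term; this is why `ζ` is
  -- free.
  rw [thetaStack, matD0_mulVec_elim, ← Sum.elim_add_add, add_zero, matS_mulVec_elim, stack_add,
    mulVec_add, matBlockSum_mulVec_matD_mulVec, matBlockSum_mulVec_gStack, chi, psi, zero_add,
    ← mulVec_neg, ← mulVec_add]
  congr 2
  abel

/-! ### The representation for members of the class. -/

namespace MemClass

variable {α : Matrix (Fin p) (Fin r) ℝ} {b ρ : ℝ} {μ : Vec r} {θ : Vec p → Vec r}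
  {ℬ : Set (Matrix (StateIdx p k) (DevIdx p k r) ℝ)}

theorem exists_norm_prod_le (hV : V.MemClass α b ρ μ θ ℬ) :
    ∃ C σ : ℝ, 0 ≤ σ ∧ σ < 1 ∧ ∀ l : List (Matrix (DevIdx p k r) (DevIdx p k r) ℝ),
      (∀ M ∈ l, M ∈ transitionSet k α ℬ) → ‖l.prod‖ ≤ C * σ ^ l.length := by
  refine exists_norm_prod_le_of_jointSpectralRadius_lt_one
    (K := ‖(1 : Matrix (DevIdx p k r) (DevIdx p k r) ℝ)‖ + |b| * ‖alphaStack k α‖) ?_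
    (hV.jsr_le.trans_lt (ENNReal.ofReal_lt_one.2 hV.rho_lt_one))
  rintro _ ⟨β, hβ, rfl⟩
  refine (norm_add_le _ _).trans (add_le_add_right ((Matrix.l2_opNorm_mul _ _).trans
    (mul_le_mul_of_nonneg_right ?_ (norm_nonneg _))) _)
  rw [Matrix.l2_opNorm_transpose]
  exact (hV.bound β hβ).trans (le_abs_self b)

/-- The map `χ` is a homeomorphism. -/
theorem exists_homeomorph_chi (hV : V.MemClass α b ρ μ θ ℬ) (hr : r ≤ p)
    {αperp : Matrix (Fin p) (Fin (p - r)) ℝ} (hrank : αperp.rank = p - r)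
    (hperp : αperpᵀ * α = 0) : ∃ X : Vec p ≃ₜ Vec p, ∀ x, X x = V.chi hr αperp θ x := by
  obtain ⟨C, σ, hσ0, hσ1, hdecay⟩ := hV.exists_norm_prod_le
  obtain ⟨B, hB⟩ := Matrix.exists_transpose_mul_eq_one_of_rank_eq hrank
  set e := hV.homeo.homeomorph (V.f 0)
  have hesymm (x : Vec p) : e.symm (V.f 0 x) = x := e.symm_apply_apply x
  have hfe (y : Vec p) : V.f 0 (e.symm y) = y := e.apply_symm_apply y
  let G : (StateIdx p k → ℝ) → DevIdx p k r → ℝ := fun s =>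
    V.thetaStack θ (e.symm (s ∘ Sum.inl)) + matD0 p k r *ᵥ s
  have hGelim (x : Vec p) (ζ : LagIdx p k → ℝ) : G (Sum.elim (V.f 0 x) ζ)
      = V.thetaStack θ x + matD0 p k r *ᵥ Sum.elim (V.f 0 x) ζ := by
    simp only [G, Sum.elim_comp_inl, hesymm]
  have hG : ∀ s s', ∃ β ∈ ℬ, G s - G s' = βᵀ *ᵥ (s - s') := by
    intro s s'
    have h := hV.gradient (s ∘ Sum.inl) (s' ∘ Sum.inl) (s ∘ Sum.inr) (s' ∘ Sum.inr)
    rwa [Sum.elim_comp_inl_inr, Sum.elim_comp_inl_inr] at h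
  -- Chosen to annihilate `𝛂`: the columns of `α` vanish under `α_⊥ᵀ`, and the block `-α_⊥ᵀ Eᵀ`
  -- cancels the `Eᵀ` of `𝛂`.
  let P : Matrix (Fin (p - r)) (StateIdx p k) ℝ :=
    Matrix.fromCols αperpᵀ (-(αperpᵀ * (matE p k)ᵀ))
  have hP (x : Vec p) (ζ : LagIdx p k → ℝ) :
      P *ᵥ Sum.elim x ζ = αperpᵀ *ᵥ (x - (matE p k)ᵀ *ᵥ ζ) := by
    rw [Matrix.fromCols_mulVec_sumElim, neg_mulVec, mulVec_sub, mulVec_mulVec, sub_eq_add_neg]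
  have hPR : P * Matrix.fromRows B (0 : Matrix (LagIdx p k) (Fin (p - r)) ℝ) = 1 := by
    rw [Matrix.fromCols_mul_fromRows, hB, Matrix.mul_zero, add_zero]
  have hPa : P * alphaStack k α = 0 := by
    rw [alphaStack, Matrix.fromCols_mul_fromBlocks, hperp]
    simp
  have hker : ∀ s, P *ᵥ s = 0 → ∃ w, s = alphaStack k α *ᵥ w := by
    intro s hs
    rw [← Sum.elim_comp_inl_inr s, hP] at hs
    obtain ⟨w, hw⟩ := Matrix.exists_eq_mulVec_of_transpose_mulVec_eq_zero hperp
      (by rw [hV.rank_eq, hrank]; omega) hs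
    refine ⟨Sum.elim w (s ∘ Sum.inr), ?_⟩
    rw [alphaStack_mulVec_elim, ← hw, sub_add_cancel, Sum.elim_comp_inl_inr]
  obtain ⟨F, hFcont, hF, hFinv⟩ := exists_continuous_inverse_of_gradient_restriction hV.bound hG
    hσ0 hσ1 hdecay hPR hPa hker
  have hchi (x : Vec p) (ζ : LagIdx p k → ℝ) : V.chi hr αperp θ x
      = stack hr (P *ᵥ Sum.elim (V.f 0 x) ζ) 0
        + matS k hr αperp *ᵥ G (Sum.elim (V.f 0 x) ζ) := by
    rw [hP, hGelim, V.chi_eq hr αperp θ x ζ]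
  let top : Vec p → Vec (p - r) := fun v i => v (splitIdx hr (Sum.inl i))
  let bot : Vec p → Vec r := fun v i => v (splitIdx hr (Sum.inr i))
  let X : Vec p ≃ Vec p :=
    { toFun := V.chi hr αperp θ
      invFun := fun v => e.symm (F (top v, Sum.elim (bot v) 0) ∘ Sum.inl)
      left_inv := fun x => by
        have htop : top (V.chi hr αperp θ x) = V.psi αperp x :=
          funext fun i => stack_apply_splitIdx_inl hr _ _ i
        have hbot : bot (V.chi hr αperp θ x) = θ x :=
          funext fun i => stack_apply_splitIdx_inr hr _ _ i
        -- Along the constant sequence `x` the lag vector `ζ` does not change, so it solves `𝐠(x) +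
        -- D ζ = 0`. At this state `G` equals `(θ x, 0)` and `P` gives `ψ x`.
        have hζ := V.gStack_add_matD_mulVec_zeta (fun _ => x) 0
        have hζ' : V.zeta (fun _ => x) 0 = V.zeta (fun _ => x) (0 - 1) := by
          ext ja
          simp only [zeta]
        rw [hζ', sub_self] at hζ
        have hGx : G (Sum.elim (V.f 0 x) (V.zeta (fun _ => x) (0 - 1))) = Sum.elim (θ x) 0 := by
          rw [hGelim, thetaStack, matD0_mulVec_elim, ← Sum.elim_add_add, add_zero, hζ]
        have hPx : P *ᵥ Sum.elim (V.f 0 x) (V.zeta (fun _ => x) (0 - 1)) = V.psi αperp x := by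
          rw [hP, matE_transpose_mulVec_zeta, psi]
        beta_reduce
        rw [htop, hbot, ← hGx, ← hPx, hFinv, Sum.elim_comp_inl, hesymm]
      right_inv := fun v => by
        set s := F (top v, Sum.elim (bot v) 0) with hs
        have h := hchi (e.symm (s ∘ Sum.inl)) (s ∘ Sum.inr)
        rw [hfe, Sum.elim_comp_inl_inr, hs, (hF _ _).1, (hF _ _).2, matS_mulVec_elim, mulVec_zero,
          mulVec_zero, neg_zero, stack_add, add_zero, zero_add] at h
        exact h.trans (stack_splitIdx hr v) }
  refine ⟨⟨X, ?_, ?_⟩, fun x => rfl⟩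
  -- Neither `θ` nor the `f_i` with `i ≥ 1` are assumed continuous; continuity of `χ` comes from
  -- that of `G` and `f_0`, with `ζ = 0` in `hchi`.
  · have hcont : Continuous fun x => Sum.elim (V.f 0 x) (0 : LagIdx p k → ℝ) := by
      refine continuous_pi fun i => ?_
      cases i with
      | inl i => exact (continuous_apply i).comp hV.homeo.continuous
      | inr i => exact continuous_const
    have hXeq : (X : Vec p → Vec p) = fun x => stack hr (P *ᵥ Sum.elim (V.f 0 x) 0) 0
        + matS k hr αperp *ᵥ G (Sum.elim (V.f 0 x) 0) := funext fun x => hchi x 0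
    show Continuous (X : Vec p → Vec p)
    rw [hXeq]
    refine Continuous.add ((continuous_stack hr).comp
      ((continuous_const.matrix_mulVec hcont).prodMk continuous_const)) ?_
    exact continuous_const.matrix_mulVec
      ((continuous_of_gradient_restriction hV.bound hG).comp hcont)
  · refine e.symm.continuous.comp ?_
    have hpair : Continuous fun v : Vec p =>
        (top v, (Sum.elim (bot v) 0 : DevIdx p k r → ℝ)) := by
      refine Continuous.prodMk (continuous_pi fun i => continuous_apply _)
        (continuous_pi fun i => ?_)
      cases i with
      | inl i => exact continuous_apply _
      | inr i => exact continuous_const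
    exact continuous_pi fun i => (continuous_apply (Sum.inl i)).comp (hFcont.comp hpair)

/-- The increments of `h̄`. -/
theorem hbar_sub_hbar (hV : V.MemClass α b ρ μ θ ℬ) (hk : 1 ≤ k) {z u : ℤ → Vec p}
    (hz : V.Follows z u) {t : ℤ} (ht : 1 ≤ t) :
    V.hbar z t - V.hbar z (t - 1) = α *ᵥ (μ + θ (z (t - 1))) + u t := by
  rw [hz.hbar_sub_hbar hk ht, hV.c_eq, hV.pi_eq, mulVec_add]

/-- The increments of `h̄` lie in the range of `α` up to the shock, so `α_⊥ᵀ` leaves only the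
cumulated shocks: these are the common trends. -/
theorem transpose_mulVec_hbar (hV : V.MemClass α b ρ μ θ ℬ) (hk : 1 ≤ k)
    {αperp : Matrix (Fin p) (Fin (p - r)) ℝ} (hperp : αperpᵀ * α = 0) {z u : ℤ → Vec p}
    (hz : V.Follows z u) {t : ℤ} (ht : 0 ≤ t) :
    αperpᵀ *ᵥ V.hbar z t
      = αperpᵀ *ᵥ V.hbar z 0 + αperpᵀ *ᵥ ∑ s ∈ Finset.Icc (1 : ℤ) t, u s := by
  induction t, ht using Int.leInduction with
  | base => simp
  | succ t ht ih =>
    have h := hV.hbar_sub_hbar hk hz (t := t + 1) (by omega)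
    rw [add_sub_cancel_right, sub_eq_iff_eq_add] at h
    have hIcc : Finset.Icc (1 : ℤ) (t + 1) = insert (t + 1) (Finset.Icc 1 t) := by
      ext i
      simp only [Finset.mem_Icc, Finset.mem_insert]
      omega
    rw [h, hIcc, Finset.sum_insert (by simp), mulVec_add, mulVec_add, mulVec_mulVec, hperp,
      zero_mulVec, zero_add, ih, mulVec_add]
    abel

/-- The deviations `𝛏_t` follow a time-varying VAR with coefficients from `ℬ`. -/
theorem exists_xi_eq (hV : V.MemClass α b ρ μ θ ℬ) (hk : 1 ≤ k) {z u : ℤ → Vec p}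
    (hz : V.Follows z u) {t : ℤ} (ht : 1 ≤ t) : ∃ β ∈ ℬ,
      V.xi μ θ z t = (1 + βᵀ * alphaStack k α) *ᵥ V.xi μ θ z (t - 1)
        + βᵀ *ᵥ shockStack k (u t) := by
  obtain ⟨β, hβ, h⟩ := hV.gradient (V.f 0 (z t)) (V.f 0 (z (t - 1)))
    (V.zeta z (t - 1)) (V.zeta z (t - 1 - 1))
  have hsymm (x : Vec p) : (hV.homeo.homeomorph (V.f 0)).symm (V.f 0 x) = x :=
    (hV.homeo.homeomorph (V.f 0)).symm_apply_apply x
  -- The columns of `𝐃_0` that meet the first block are zero, so `f_0(z_s)` may replace `z_s` there.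
  have hxi (s : ℤ) : V.thetaStack θ (z s) + matD0 p k r *ᵥ Sum.elim (V.f 0 (z s)) (V.zeta z (s - 1))
      = V.xi μ θ z s - Sum.elim μ 0 := by
    rw [xi, state, matD0_mulVec_elim, matD0_mulVec_elim]
    abel
  -- As `f_0(z_t) = h̄_t + Eᵀ ζ_{t-1}`, its increment is that of `h̄` plus `Eᵀ Δζ_{t-1}`: the first
  -- block row of `𝛂`.
  have hdiff : Sum.elim (V.f 0 (z t)) (V.zeta z (t - 1))
      - Sum.elim (V.f 0 (z (t - 1))) (V.zeta z (t - 1 - 1))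
      = alphaStack k α *ᵥ V.xi μ θ z (t - 1) + shockStack k (u t) := by
    have hh := hV.hbar_sub_hbar hk hz ht
    rw [hbar_eq, hbar_eq] at hh
    rw [xi_eq, alphaStack_mulVec_elim, shockStack, ← Sum.elim_add_add, ← Sum.elim_sub_sub, add_zero,
      mulVec_sub]
    congr 1
    linear_combination (exp := 1) hh
  rw [hsymm, hsymm, hxi, hxi, sub_sub_sub_cancel_right, hdiff, mulVec_add, mulVec_mulVec,
    sub_eq_iff_eq_add] at h
  refine ⟨β, hβ, ?_⟩
  rw [h, add_mulVec, one_mulVec]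
  abel

end MemClass

end NonlinVAR

theorem mainTheorem1 {p k r : ℕ} (hk : 1 ≤ k) (hr : r ≤ p) (V : NonlinVAR p k)
    (α : Matrix (Fin p) (Fin r) ℝ) (b ρ : ℝ) (μ : Vec r) (θ : Vec p → Vec r)
    (ℬ : Set (Matrix (StateIdx p k) (DevIdx p k r) ℝ))
    (hV : V.MemClass α b ρ μ θ ℬ)
    (αperp : Matrix (Fin p) (Fin (p - r)) ℝ) (hperp_rank : αperp.rank = p - r)
    (hperp : αperpᵀ * α = 0)
    (z u : ℤ → Vec p) (hz : V.Follows z u) :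
    (∃ X : Vec p ≃ₜ Vec p, (∀ x : Vec p, X x = V.chi hr αperp θ x) ∧
      ∀ t : ℤ, 0 ≤ t →
        z t = X.symm
          (stack hr (αperpᵀ *ᵥ V.hbar z 0 + αperpᵀ *ᵥ ∑ s ∈ Finset.Icc (1 : ℤ) t, u s) (-μ)
            + matS k hr αperp *ᵥ V.xi μ θ z t)) ∧
    (∀ t : ℤ, 0 ≤ t →
      V.xi μ θ z t = Sum.elim (μ + θ (z t)) (V.zeta z t - V.zeta z (t - 1))) ∧
    ∃ β : ℤ → Matrix (StateIdx p k) (DevIdx p k r) ℝ,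
      (∀ t : ℤ, 1 ≤ t → β t ∈ ℬ ∧
        V.xi μ θ z t = (1 + (β t)ᵀ * alphaStack k α) *ᵥ V.xi μ θ z (t - 1)
          + (β t)ᵀ *ᵥ shockStack k (u t)) ∧
      ExpStableVAR (transitionSet k α ℬ) {B | ∃ β ∈ ℬ, B = βᵀ} {0}
        (fun _ => 0) (fun t => 1 + (β t)ᵀ * alphaStack k α) (fun t => (β t)ᵀ)
        (fun t => shockStack k (u t)) (V.xi μ θ z) := by
  refine ⟨?_, fun t _ => V.xi_eq μ θ z t, ?_⟩
  · obtain ⟨X, hX⟩ := hV.exists_homeomorph_chi hr hperp_rank hperp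
    refine ⟨X, hX, fun t ht => ?_⟩
    -- With the actual lag vector `ζ_{t-1}` in `chi_eq`, the first term is `α_⊥ᵀ h̄_t` and `G` is
    -- `𝛏_t` without `𝛍`; the entry `-μ` makes up for the difference.
    rw [Homeomorph.eq_symm_apply, hX, V.chi_eq hr αperp θ (z t) (V.zeta z (t - 1)), ← V.hbar_eq,
      hV.transpose_mulVec_hbar hk hperp hz ht, V.xi_eq, NonlinVAR.thetaStack, matD0_mulVec_elim,
      ← Sum.elim_add_add, V.gStack_add_matD_mulVec_zeta, matS_mulVec_elim, matS_mulVec_elim,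
      stack_add, stack_add]
    congr 1
    abel
  · choose! β hβ using fun (t : ℤ) (ht : 1 ≤ t) => hV.exists_xi_eq hk hz ht
    refine ⟨β, hβ, fun t ht => ?_, ?_, Bornology.isBounded_singleton, hV.exists_norm_prod_le⟩
    · refine ⟨⟨β t, (hβ t ht).1, rfl⟩, ⟨β t, (hβ t ht).1, rfl⟩, rfl, ?_⟩
      rw [zero_add]
      exact (hβ t ht).2
    · refine isBounded_iff_forall_norm_le.2 ⟨b, ?_⟩
      rintro _ ⟨β', hβ', rfl⟩
      rw [Matrix.l2_opNorm_transpose]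
      exact hV.bound β' hβ'
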